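/- Let $d\le 3$, let $K\subset\mathbb{R}^d$ be a convex body (a compact convex set with nonempty interior) that is $0$-symmetric ($K=-K$), and let $\Lambda$ be a lattice in $\mathbb{R}^d$ (a discrete subgroup that spans $\mathbb{R}^d$). Write $G(K,\Lambda)=\#(K\cap\Lambda)$ for the number of lattice points in $K$, and for $1\le i\le d$ let $$\lambda_i(K,\Lambda)=\inf\{\lambda>0 : \dim(\lambda K\cap\Lambda)\ge i\}$$ be the $i$-th successive minimum, where $\dim A$ denotes the dimension of the linear span of $A\subset\mathbb{R}^d$. Then $$G(K,\Lambda)\le\prod_{i=1}^{d}\left\lfloor\frac{2}{\lambda_i(K,\Lambda)}+1\right\rfloor .$$ -/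

import Mathlib

open scoped Pointwise

/-- The lattice point enumerator `G(K, Λ) = #(K ∩ Λ)`, valued in `ℕ∞`
(so that an infinite intersection counts as `⊤`). -/
noncomputable def latticePointEnumerator {d : ℕ} (K : Set (EuclideanSpace ℝ (Fin d)))
    (Λ : Submodule ℤ (EuclideanSpace ℝ (Fin d))) : ℕ∞ :=
  (K ∩ (Λ : Set (EuclideanSpace ℝ (Fin d)))).encard

/-- The `i`-th successive minimum
`λ_i(K, Λ) = inf {r > 0 | dim (r K ∩ Λ) ≥ i}`, where the dimension of a set is the dimension
of its real linear span. The index `i` runs over `1, …, d`. -/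
noncomputable def successiveMinimum {d : ℕ} (K : Set (EuclideanSpace ℝ (Fin d)))
    (Λ : Submodule ℤ (EuclideanSpace ℝ (Fin d))) (i : ℕ) : ℝ :=
  sInf {r : ℝ | 0 < r ∧
    i ≤ Module.finrank ℝ
      (Submodule.span ℝ ((r • K) ∩ (Λ : Set (EuclideanSpace ℝ (Fin d)))))}

/-! Put q_i = ⌊2/λ_i + 1⌋, so that q_i λ_i > 2 and q₁ ≥ q₂ ≥ q₃. Choose a lattice basis e₁, e₂, e₃
whose flag 0 ⊂ W₁ ⊂ W₂ is adapted to the minima: a lattice point outside W_{i-1} lies in rK only if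
r ≥ λ_i. Since K - K ⊆ 2K, two points of K that differ by q_i x with x ∈ Λ have x ∈ W_{i-1}
(`mem_of_sub_eq_smul`). In basis coordinates the theorem becomes a count of integer points in a
convex set under these packing conditions and a bound 2q₂ on the extent of planar sections
(`sub_coordinate_lt`).

In dimension 3, split the heights into classes modulo q₃; each class carries at most q₁q₂ points
(`card_layers_le`). The layers of a class are disjoint modulo q₃. Two lattice points of one layer
that are congruent modulo q₃ span a closed geodesic of the torus, and non-parallel closed geodesics
meet. So if two layers contain such pairs, all pairs have one direction, and counting along lines of
that direction gives at most q₁q₃. Otherwise all layers but one contribute distinct residues modulo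
q₃, all of them missed by the exceptional layer.

The crux is then `card_planar_add_card_missing_le`: the points of a planar section plus the residues
it misses number at most q₁q₂. Its rows are grouped modulo q₂, at most two to a group. A single row
is handled by `card_le_of_rows`; for two rows the missed residues are slid into the gaps between
them (`card_two_rows_add_card_gaps_le`). The plane is the case without missed residues, the line
that of a single row. -/

/-! ### Integers in one or two rows -/

/-- A family of intervals of integers, pairwise disjoint modulo `q` and none of which contains two
points at distance `m ≥ q`, has at most `m` points altogether. The points are the elements of `S`;
`f` gives the interval and `g` the position in it. -/
theorem card_le_of_rows {α ι : Type*} (S : Finset α) (f : α → ι) (g : α → ℤ) (q m : ℕ)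
    (hq : 0 < q) (hqm : q ≤ m)
    (hinj : ∀ a ∈ S, ∀ b ∈ S, f a = f b → g a = g b → a = b)
    (hconn : ∀ a ∈ S, ∀ b ∈ S, f a = f b → ∀ z, g a ≤ z → z ≤ g b →
      ∃ c ∈ S, f c = f a ∧ g c = z)
    (hdisj : ∀ a ∈ S, ∀ b ∈ S, f a ≠ f b → ¬ (q : ℤ) ∣ g a - g b)
    (hm : ∀ a ∈ S, ∀ b ∈ S, f a = f b → g b ≠ g a + m) : S.card ≤ m := by
  have key : ∀ n : ℕ, 0 < n → (∀ a ∈ S, ∀ b ∈ S, (n : ℤ) ∣ g b - g a → g a < g b → False) →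
      (∀ a ∈ S, ∀ b ∈ S, (n : ℤ) ∣ g b - g a → f a = f b) → S.card ≤ n := by
    intro n hn h1 h2
    have : S.card ≤ (Finset.Ico (0 : ℤ) n).card := by
      refine Finset.card_le_card_of_injOn (fun a => g a % n) ?_ ?_
      · intro a _
        simp only [Finset.coe_Ico, Set.mem_Ico]
        exact ⟨Int.emod_nonneg _ (by omega), Int.emod_lt_of_pos _ (by omega)⟩
      · intro a ha b hb hab
        have hdvd : (n : ℤ) ∣ g b - g a := Int.ModEq.dvd hab
        have hdvd' : (n : ℤ) ∣ g a - g b := by rw [← neg_sub]; exact hdvd.neg_right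
        refine hinj a ha b hb (h2 a ha b hb hdvd) ?_
        rcases lt_trichotomy (g a) (g b) with h | h | h
        · exact (h1 a ha b hb hdvd h).elim
        · exact h
        · exact (h1 b hb a ha hdvd' h).elim
    simpa using this
  -- A lone interval has no two points at distance m, so it is injective modulo m. With two or more
  -- intervals, one holding two points congruent modulo q would cover every residue modulo q and so
  -- meet another interval; hence everything is injective modulo q.
  by_cases hall : ∀ a ∈ S, ∀ b ∈ S, f a = f b
  · refine key m (by omega) (fun a ha b hb hd hlt => ?_) (fun a ha b hb _ => hall a ha b hb)
    have := Int.le_of_dvd (by omega) hd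
    obtain ⟨c, hc, hfc, hgc⟩ := hconn a ha b hb (hall a ha b hb) (g a + m) (by omega) (by omega)
    exact hm a ha c hc hfc.symm hgc
  · push Not at hall
    obtain ⟨a₀, ha₀, b₀, hb₀, hne⟩ := hall
    have hf : ∀ a ∈ S, ∀ b ∈ S, (q : ℤ) ∣ g b - g a → f a = f b := by
      intro a ha b hb hd
      by_contra h
      exact hdisj b hb a ha (Ne.symm h) hd
    refine (key q hq (fun a ha b hb hd hlt => ?_) hf).trans hqm
    obtain ⟨c₀, hc₀, hc₀a⟩ : ∃ c ∈ S, f c ≠ f a := by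
      by_contra! h
      exact hne ((h a₀ ha₀).trans (h b₀ hb₀).symm)
    have hle := Int.le_of_dvd (by omega) hd
    have hr0 := Int.emod_nonneg (g c₀ - g a) (b := q) (by omega)
    have hr1 := Int.emod_lt_of_pos (g c₀ - g a) (b := q) (by omega)
    obtain ⟨c, hc, hfc, hgc⟩ := hconn a ha b hb (hf a ha b hb hd)
      (g a + (g c₀ - g a) % q) (by omega) (by omega)
    refine hdisj c hc c₀ hc₀ (by rw [hfc]; exact hc₀a.symm) ?_
    rw [hgc]
    have h3 := Int.mul_ediv_add_emod (g c₀ - g a) q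
    exact ⟨-((g c₀ - g a) / q), by linarith⟩

theorem exists_row_eq_Icc {C : Set (ℝ × ℝ)} (hC : IsCompact C) (hconv : Convex ℝ C) {t : ℝ}
    (hne : ∃ s, (s, t) ∈ C) :
    ∃ a a' : ℝ, a ≤ a' ∧ ∀ s, (s, t) ∈ C ↔ a ≤ s ∧ s ≤ a' := by
  have hcont : Continuous fun s : ℝ => (s, t) := by fun_prop
  have hemb : Topology.IsClosedEmbedding fun s : ℝ => (s, t) := by
    refine Topology.IsClosedEmbedding.of_continuous_injective_isClosedMap hcont
      (fun a b h => by simpa using h) ?_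
    exact isClosedMap_prodMk_right t
  have hcomp : IsCompact {s : ℝ | (s, t) ∈ C} := hemb.isCompact_preimage hC
  obtain ⟨a, ha⟩ := hcomp.exists_isLeast hne
  obtain ⟨a', ha'⟩ := hcomp.exists_isGreatest hne
  refine ⟨a, a', ha.2 ha'.1, fun s => ⟨fun h => ⟨ha.2 h, ha'.2 h⟩, fun ⟨h1, h2⟩ => ?_⟩⟩
  have hc2 : Convex ℝ {s : ℝ | (s, t) ∈ C} := by
    intro x hx y hy u v hu hv huv
    have := hconv hx hy hu hv huv
    simp only [Prod.smul_mk, smul_eq_mul, Prod.mk_add_mk] at this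
    rw [← add_mul, huv, one_mul] at this
    simpa using this
  exact hc2.ordConnected.out ha.1 ha'.1 ⟨h1, h2⟩

/-- After a shear by k per unit of height, the gap from x to y has width y - x - kr ≥ 0 at height r
and only the fraction q/r ≤ 1 of that at height q. A point that fits to the left of the boundary at
height q therefore still fits at height r. -/
theorem lt_of_lt_interpolation {x y n q r k : ℝ} (hq : 0 < q) (hqr : q ≤ r)
    (hy : k * r ≤ y - x) (h : n < x + q / r * (y - x)) : n + k * (r - q) < y := by
  have hr : 0 < r := hq.trans_le hqr
  have h1 : q / r * (y - x - k * r) ≤ 1 * (y - x - k * r) :=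
    mul_le_mul_of_nonneg_right ((div_le_one hr).2 hqr) (by linarith)
  have h2 : q / r * (y - x - k * r) = q / r * (y - x) - k * q := by field_simp
  linarith

theorem interpolation_lt_of_lt {x y n q r k : ℝ} (hq : 0 < q) (hqr : q ≤ r)
    (hy : y - x ≤ k * r) (h : x + q / r * (y - x) < n) : y < n + k * (r - q) := by
  have hr : 0 < r := hq.trans_le hqr
  have h1 : q / r * (k * r - (y - x)) ≤ 1 * (k * r - (y - x)) :=
    mul_le_mul_of_nonneg_right ((div_le_one hr).2 hqr) (by linarith)
  have h2 : q / r * (k * r - (y - x)) = k * q - q / r * (y - x) := by field_simp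
  linarith

/-- Two rows of a planar convex set at heights `t` and `t + r`, disjoint modulo `r`: the integers in
them, together with the residues modulo `q ≤ r` avoided by the rows at heights `t` and `t + q`,
number at most `r`. -/
theorem card_two_rows_add_card_gaps_le {α : Type*} (S T N : Finset α) (s : α → ℤ) {q r : ℕ}
    (hq : 0 < q) (hqr : q ≤ r) {a a' b b' e e' : ℝ} (haa : a ≤ a') (hbb : b ≤ b')
    (hS : ∀ x ∈ S, a ≤ s x ∧ s x ≤ a') (hT : ∀ x ∈ T, b ≤ s x ∧ s x ≤ b')
    (hSi : Set.InjOn s S) (hTi : Set.InjOn s T)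
    (hNi : ∀ x ∈ N, ∀ y ∈ N, (q : ℤ) ∣ s x - s y → x = y)
    (hab : ∀ x y : ℝ, a ≤ x → x ≤ a' → b ≤ y → y ≤ b' → ∀ k : ℤ, y - x ≠ r * k)
    (he : e ≤ a' + q / r * (b - a')) (he' : a + q / r * (b' - a) ≤ e')
    (hN : ∀ x ∈ N, ∀ n : ℤ, (q : ℤ) ∣ n - s x → ¬ (a ≤ n ∧ n ≤ a') ∧ ¬ (e ≤ n ∧ n ≤ e')) :
    S.card + T.card + N.card ≤ r := by
  have hr : 0 < r := hq.trans_le hqr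
  have hrR : (0 : ℝ) < r := by exact_mod_cast hr
  have hqR : (0 : ℝ) < q := by exact_mod_cast hq
  have hqrR : (q : ℝ) ≤ r := by exact_mod_cast hqr
  -- This k places [b, b'] strictly between the translates of [a, a'] by kr and by (k+1)r.
  set k : ℤ := ⌊(b - a') / r⌋ with hk
  have hk1 : k * (r : ℝ) < b - a' := by
    have h1 : (k : ℝ) ≤ (b - a') / r := Int.floor_le _
    rw [le_div_iff₀ hrR] at h1
    refine lt_of_le_of_ne h1 fun h => hab a' b haa le_rfl le_rfl hbb k ?_
    rw [← h, mul_comm]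
  have hk2 : b - a' < (k + 1) * r := by
    have h1 : (b - a') / r < k + 1 := Int.lt_floor_add_one _
    rwa [div_lt_iff₀ hrR] at h1
  have hk3 : b' - a < (k + 1) * r := by
    by_contra! h
    have hpos : 0 < b' - a - (b - a') := by linarith
    -- Intermediate value: as x runs from a' to a and y from b to b', the difference y - x would
    -- pass through (k+1)r, which `hab` forbids.
    set τ := ((k + 1) * r - (b - a')) / (b' - a - (b - a')) with hτ
    have h0 : 0 ≤ τ := div_nonneg (by linarith) hpos.le
    have h1 : τ ≤ 1 := (div_le_one hpos).2 (by linarith)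
    have hmul : τ * (b' - a - (b - a')) = (k + 1) * r - (b - a') :=
      div_mul_cancel₀ _ hpos.ne'
    refine hab (a' + τ * (a - a')) (b + τ * (b' - b)) ?_ ?_ ?_ ?_ (k + 1) ?_
    · nlinarith
    · nlinarith
    · nlinarith
    · nlinarith
    · push_cast; linarith
  -- representatives of the avoided residues
  set L : ℤ := ⌈a⌉ + k * q with hL
  let ρ : α → ℤ := fun x => L + (s x - L) % q
  have hρ0 : ∀ x, L ≤ ρ x := fun x => by
    have := Int.emod_nonneg (s x - L) (b := q) (by omega)
    simp only [ρ]; omega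
  have hρ1 : ∀ x, ρ x < L + q := fun x => by
    have := Int.emod_lt_of_pos (s x - L) (b := q) (by omega)
    simp only [ρ]; omega
  have hρd : ∀ x, (q : ℤ) ∣ ρ x - s x := fun x => by
    have h3 := Int.mul_ediv_add_emod (s x - L) q
    exact ⟨-((s x - L) / q), by simp only [ρ]; linarith⟩
  have hρ0R : ∀ x, a + k * q ≤ (ρ x : ℝ) := fun x => by
    have h1 : ((⌈a⌉ + k * q : ℤ) : ℝ) ≤ ρ x := by exact_mod_cast hρ0 x
    push_cast at h1
    linarith [Int.le_ceil a]
  have hρ1R : ∀ x, (ρ x : ℝ) < a + (k + 1) * q := fun x => by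
    have h1 : ((ρ x + 1 : ℤ) : ℝ) ≤ (⌈a⌉ + k * q + q : ℤ) := by
      have := hρ1 x
      exact_mod_cast (by omega : ρ x + 1 ≤ L + q)
    push_cast at h1
    linarith [Int.ceil_lt_add_one a]
  have hρa : ∀ x ∈ N, a' + k * q < (ρ x : ℝ) := fun x hx => by
    by_contra! h
    refine (hN x hx (ρ x - k * q) ?_).1 ⟨?_, ?_⟩
    · rw [sub_right_comm]; exact dvd_sub (hρd x) (Dvd.intro_left _ rfl)
    · push_cast; linarith [hρ0R x]
    · push_cast; linarith
  -- The representative ρ lies between a' + kq and a + (k+1)q and misses [e, e']. On the left of e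
  -- it is sheared into the gap (a' + kr, b), on the right of e' into the gap (b', a + (k+1)r).
  let σ : α → ℤ := fun x =>
    if (ρ x : ℝ) < e then ρ x + k * (r - q) else ρ x + (k + 1) * (r - q)
  have hσlow : ∀ x ∈ N, (ρ x : ℝ) < e → a' + k * r < (σ x : ℝ) ∧ (σ x : ℝ) < b := by
    intro x hx h
    have h1 := lt_of_lt_interpolation hqR hqrR hk1.le (h.trans_le he)
    simp only [σ, if_pos h]
    push_cast
    exact ⟨by linarith [hρa x hx], h1⟩
  have hσhigh : ∀ x ∈ N, ¬ (ρ x : ℝ) < e → b' < (σ x : ℝ) ∧ (σ x : ℝ) < a + (k + 1) * r := by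
    intro x hx h
    have h2 : e' < ρ x := by
      by_contra! h3
      exact (hN x hx (ρ x) (hρd x)).2 ⟨not_lt.1 h, h3⟩
    have h1 := interpolation_lt_of_lt (k := k + 1) hqR hqrR hk3.le (he'.trans_lt h2)
    simp only [σ, if_neg h]
    push_cast
    exact ⟨h1, by linarith [hρ1R x]⟩
  have hσinj : Set.InjOn σ N := by
    intro x hx y hy hxy
    have hcase : ρ x = ρ y := by
      by_cases h1 : (ρ x : ℝ) < e <;> by_cases h2 : (ρ y : ℝ) < e
      · simpa [σ, h1, h2] using hxy
      · have := (hσlow x hx h1).2; have := (hσhigh y hy h2).1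
        rw [hxy] at *; linarith
      · have := (hσlow y hy h2).2; have := (hσhigh x hx h1).1
        rw [hxy] at *; linarith
      · simpa [σ, h1, h2] using hxy
    refine hNi x hx y hy ?_
    have := dvd_sub (hρd y) (hρd x)
    rwa [hcase, sub_sub_sub_cancel_left] at this
  have hS' : ∀ x ∈ S, a + k * r ≤ ((s x + k * r : ℤ) : ℝ) ∧ ((s x + k * r : ℤ) : ℝ) ≤ a' + k * r :=
    fun x hx => by push_cast; exact ⟨by linarith [(hS x hx).1], by linarith [(hS x hx).2]⟩
  have hmem : ∀ n : ℤ, a + k * r ≤ n → (n : ℝ) < a + (k + 1) * r →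
      n ∈ Finset.Ico (⌈a⌉ + k * r) (⌈a⌉ + k * r + r) := by
    intro n h1 h2
    rw [Finset.mem_Ico]
    constructor
    · have : ⌈a⌉ ≤ n - k * r := Int.ceil_le.2 (by push_cast; linarith)
      linarith
    · have : ((n - k * r - r : ℤ) : ℝ) < a := by push_cast; linarith
      have := Int.lt_ceil.2 this
      linarith
  -- S shifted by kr, T, and the slid residues occupy distinct integers of one half-open interval of
  -- length r.
  have hcard : ((S.disjSum T).disjSum N).card ≤
      (Finset.Ico (⌈a⌉ + k * r) (⌈a⌉ + k * r + r)).card := by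
    refine Finset.card_le_card_of_injOn
      (Sum.elim (Sum.elim (fun x => s x + k * r) s) σ) ?_ ?_
    · intro x hx
      rw [Finset.mem_coe] at hx ⊢
      rcases x with (x | x) | x
      · have hx' : x ∈ S := by simpa using hx
        have := hS' x hx'
        exact hmem _ this.1 (by simp only [Sum.elim_inl]; linarith)
      · have hx' : x ∈ T := by simpa using hx
        have := hT x hx'
        exact hmem _ (by simp only [Sum.elim_inl, Sum.elim_inr]; linarith)
          (by simp only [Sum.elim_inl, Sum.elim_inr]; linarith)
      · have hx' : x ∈ N := by simpa using hx
        by_cases h : (ρ x : ℝ) < e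
        · have := hσlow x hx' h
          exact hmem _ (by simp only [Sum.elim_inr]; linarith)
            (by simp only [Sum.elim_inr]; linarith)
        · have := hσhigh x hx' h
          exact hmem _ (by simp only [Sum.elim_inr]; linarith)
            (by simp only [Sum.elim_inr]; linarith)
    · have hST : ∀ x ∈ S, ∀ y ∈ T, s x + k * r ≠ s y := fun x hx y hy h => by
        have h1 := (hS' x hx).2; have h2 := (hT y hy).1
        rw [h] at h1; linarith
      have hSN : ∀ x ∈ S, ∀ y ∈ N, s x + k * r ≠ σ y := fun x hx y hy h => by
        have h1 := (hS' x hx).2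
        rw [h] at h1
        by_cases h3 : (ρ y : ℝ) < e
        · linarith [(hσlow y hy h3).1]
        · linarith [(hσhigh y hy h3).1]
      have hTN : ∀ x ∈ T, ∀ y ∈ N, s x ≠ σ y := fun x hx y hy h => by
        have h1 := hT x hx
        rw [h] at h1
        by_cases h3 : (ρ y : ℝ) < e
        · linarith [(hσlow y hy h3).2]
        · linarith [(hσhigh y hy h3).1]
      rintro ((x | x) | x) hx ((y | y) | y) hy hxy <;>
        simp only [Finset.mem_coe, Finset.inl_mem_disjSum, Finset.inr_mem_disjSum] at hx hy <;>
        simp only [Sum.elim_inl, Sum.elim_inr] at hxy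
      · rw [hSi hx hy (by linarith)]
      · exact (hST x hx y hy hxy).elim
      · exact (hSN x hx y hy hxy).elim
      · exact (hST y hy x hx hxy.symm).elim
      · rw [hTi hx hy hxy]
      · exact (hTN x hx y hy hxy).elim
      · exact (hSN y hy x hx hxy.symm).elim
      · exact (hTN y hy x hx hxy.symm).elim
      · rw [hσinj hx hy hxy]
  simpa [Finset.card_disjSum] using hcard

/-! ### Planar sections and missed residues -/

/-- Lattice points of a planar convex set, together with points in further residue classes modulo
`q`, when the set satisfies the packing conditions at scales `q₁ ≥ q₂ ≥ q` and has height less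
than `2 q₂`. -/
theorem card_planar_add_card_missing_le {C : Set (ℝ × ℝ)} (hC : IsCompact C) (hconv : Convex ℝ C)
    {q q₂ q₁ : ℕ} (hq : 0 < q) (hq2 : q ≤ q₂) (hq1 : q₂ ≤ q₁)
    (h2 : ∀ p ∈ C, ∀ p' ∈ C, ∀ a b : ℤ, p.1 - p'.1 = q₂ * a → p.2 - p'.2 = q₂ * b → b = 0)
    (h1 : ∀ p ∈ C, ∀ p' ∈ C, ∀ a : ℤ, p.1 - p'.1 = q₁ * a → p.2 = p'.2 → a = 0)
    (hheight : ∀ p ∈ C, ∀ p' ∈ C, p.2 - p'.2 < 2 * q₂)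
    (A N : Finset (ℤ × ℤ)) (hA : ∀ x, x ∈ A ↔ ((x.1 : ℝ), (x.2 : ℝ)) ∈ C)
    (hN : ∀ m ∈ N, ∀ n ∈ N, (q : ℤ) ∣ m.1 - n.1 → (q : ℤ) ∣ m.2 - n.2 → m = n)
    (hNA : ∀ m ∈ N, ∀ a ∈ A, (q : ℤ) ∣ m.1 - a.1 → ¬ (q : ℤ) ∣ m.2 - a.2) :
    A.card + N.card ≤ q₁ * q₂ := by
  have hq₂ : 0 < q₂ := by omega
  have hqR : (0 : ℝ) < q := by exact_mod_cast hq
  have hq₂R : (0 : ℝ) < q₂ := by exact_mod_cast hq₂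
  have hqq : (q : ℝ) ≤ q₂ := by exact_mod_cast hq2
  obtain ⟨t₀, ht₀, ht₀'⟩ : ∃ t₀ : ℤ, (∀ a ∈ A, t₀ ≤ a.2) ∧ (A.Nonempty → ∃ a ∈ A, a.2 = t₀) := by
    rcases A.eq_empty_or_nonempty with h | h
    · exact ⟨0, by simp [h], by simp [h]⟩
    · obtain ⟨a, ha, hmin⟩ := A.exists_min_image (fun a => a.2) h
      exact ⟨a.2, hmin, fun _ => ⟨a, ha, rfl⟩⟩
  have ht₁ : ∀ a ∈ A, a.2 < t₀ + 2 * q₂ := fun a ha => by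
    obtain ⟨b, hb, hbt⟩ := ht₀' ⟨a, ha⟩
    have := hheight _ ((hA a).1 ha) _ ((hA b).1 hb)
    have h3 : ((a.2 - b.2 : ℤ) : ℝ) < (2 * q₂ : ℤ) := by push_cast; exact this
    have := Int.cast_lt.1 h3
    omega
  -- Heights of A are folded modulo q₂ and those of N modulo q, both counted from the lowest row t₀
  -- of A. Since q ≤ q₂, there are q₂ groups in all, and the height bound leaves only rows t and t +
  -- q₂ of A in group t.
  let F : (ℤ × ℤ) ⊕ (ℤ × ℤ) → ℤ :=
    Sum.elim (fun x => t₀ + (x.2 - t₀) % q₂) (fun x => t₀ + (x.2 - t₀) % q)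
  have hmaps : ∀ x ∈ A.disjSum N, F x ∈ Finset.Ico t₀ (t₀ + q₂) := by
    rintro (x | x) _ <;> simp only [F, Sum.elim_inl, Sum.elim_inr, Finset.mem_Ico]
    · have := Int.emod_nonneg (x.2 - t₀) (b := q₂) (by omega)
      have := Int.emod_lt_of_pos (x.2 - t₀) (b := q₂) (by omega)
      omega
    · have := Int.emod_nonneg (x.2 - t₀) (b := q) (by omega)
      have := Int.emod_lt_of_pos (x.2 - t₀) (b := q) (by omega)
      omega
  have hFA : ∀ x ∈ A, ∀ t, F (Sum.inl x) = t → x.2 = t ∨ x.2 = t + q₂ := by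
    intro x hx t h
    simp only [F, Sum.elim_inl] at h
    have h3 := Int.mul_ediv_add_emod (x.2 - t₀) q₂
    have h4 : 0 ≤ (x.2 - t₀) / q₂ := Int.ediv_nonneg (by linarith [ht₀ x hx]) (by omega)
    have h5 : (x.2 - t₀) / q₂ < 2 := Int.ediv_lt_of_lt_mul (by omega) (by linarith [ht₁ x hx])
    generalize (x.2 - t₀) / (q₂ : ℤ) = u at *
    interval_cases u <;> omega
  have hFN : ∀ x t, F (Sum.inr x) = t → (q : ℤ) ∣ x.2 - t := by
    intro x t h
    simp only [F, Sum.elim_inr] at h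
    have h3 := Int.mul_ediv_add_emod (x.2 - t₀) q
    exact ⟨(x.2 - t₀) / q, by linarith⟩
  have hfib : ∀ t ∈ Finset.Ico t₀ (t₀ + q₂),
      ((A.disjSum N).filter fun x => F x = t).card ≤ q₁ := by
    intro t ht
    rw [Finset.mem_Ico] at ht
    by_cases hrow : ∃ x ∈ A, x.2 = t + q₂
    · obtain ⟨x₁, hx₁, hx₁t⟩ := hrow
      obtain ⟨x₀, hx₀, hx₀t⟩ := ht₀' ⟨x₁, hx₁⟩
      have hseg : ∀ {s s' u u' : ℝ} (τ : ℝ), (s, u) ∈ C → (s', u') ∈ C → 0 ≤ τ → τ ≤ 1 →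
          (s + τ * (s' - s), u + τ * (u' - u)) ∈ C := by
        intro s s' u u' τ h h' h0 h1
        have := hconv h h' (sub_nonneg.2 h1) h0 (by ring)
        convert this using 1
        simp only [Prod.smul_mk, smul_eq_mul, Prod.mk_add_mk, Prod.mk.injEq]
        constructor <;> ring
      have hxC : ((x₁.1 : ℝ), (t : ℝ) + q₂) ∈ C := by
        have := (hA x₁).1 hx₁
        rwa [hx₁t, Int.cast_add, Int.cast_natCast] at this
      -- Row t may contain no lattice point, but the segment from the lowest point of A to row t +
      -- q₂ crosses it.
      have hrow_t : ∃ s, (s, (t : ℝ)) ∈ C := by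
        have h0 : ((x₀.1 : ℝ), (t₀ : ℝ)) ∈ C := by
          have := (hA x₀).1 hx₀
          rwa [hx₀t] at this
        have htt : (t₀ : ℝ) ≤ t := by exact_mod_cast ht.1
        have hpos : (0 : ℝ) < t + q₂ - t₀ := by linarith
        have := hseg ((t - t₀) / (t + q₂ - t₀)) h0 hxC (div_nonneg (by linarith) hpos.le)
          ((div_le_one hpos).2 (by linarith))
        rw [div_mul_cancel₀ _ hpos.ne', add_sub_cancel] at this
        exact ⟨_, this⟩
      obtain ⟨a, a', haa, hIa⟩ := exists_row_eq_Icc hC hconv hrow_t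
      obtain ⟨b, b', hbb, hIb⟩ := exists_row_eq_Icc hC hconv ⟨_, hxC⟩
      have hθ0 : (0 : ℝ) ≤ q / q₂ := by positivity
      have hθ1 : (q : ℝ) / q₂ ≤ 1 := (div_le_one hq₂R).2 hqq
      have hmid : ∀ {s s' : ℝ}, (s, (t : ℝ)) ∈ C → (s', (t : ℝ) + q₂) ∈ C →
          (s + q / q₂ * (s' - s), (t : ℝ) + q) ∈ C := by
        intro s s' h h'
        have := hseg (q / q₂) h h' hθ0 hθ1
        rwa [add_sub_cancel_left, div_mul_cancel₀ _ hq₂R.ne'] at this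
      have haC := (hIa a).2 ⟨le_rfl, haa⟩
      have haC' := (hIa a').2 ⟨haa, le_rfl⟩
      have hbC := (hIb b).2 ⟨le_rfl, hbb⟩
      have hbC' := (hIb b').2 ⟨hbb, le_rfl⟩
      obtain ⟨e, e', -, hIe⟩ := exists_row_eq_Icc hC hconv ⟨_, hmid haC hbC⟩
      have hdis : ∀ x y : ℝ, a ≤ x → x ≤ a' → b ≤ y → y ≤ b' → ∀ k : ℤ, y - x ≠ q₂ * k := by
        intro x y hx hx' hy hy' k hk
        have := h2 _ ((hIb y).2 ⟨hy, hy'⟩) _ ((hIa x).2 ⟨hx, hx'⟩) k 1 hk (by simp)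
        omega
      have hsub : ((A.disjSum N).filter fun x => F x = t) ⊆
          ((A.filter fun x => x.2 = t).disjUnion (A.filter fun x => x.2 = t + q₂)
            (Finset.disjoint_filter.2 fun x _ h h' => by omega)).disjSum
            (N.filter fun x => (q : ℤ) ∣ x.2 - t) := by
        rintro (x | x) hx <;>
          simp only [Finset.mem_filter, Finset.inl_mem_disjSum, Finset.inr_mem_disjSum,
            Finset.mem_disjUnion] at hx ⊢
        · rcases hFA x hx.1 t hx.2 with h | h
          · exact Or.inl ⟨hx.1, h⟩
          · exact Or.inr ⟨hx.1, h⟩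
        · exact ⟨hx.1, hFN x t hx.2⟩
      have hA' : ∀ x : ℤ × ℤ, x ∈ A → x.2 = t → a ≤ x.1 ∧ (x.1 : ℝ) ≤ a' := fun x hx h => by
        rw [← hIa, ← h]; exact (hA x).1 hx
      refine (Finset.card_le_card hsub).trans ?_
      rw [Finset.card_disjSum, Finset.card_disjUnion]
      refine le_trans (card_two_rows_add_card_gaps_le _ _ _ (fun x => x.1) hq hq2 haa hbb
        (fun x hx => ?_) (fun x hx => ?_) ?_ ?_ ?_ hdis ((hIe _).1 (hmid haC' hbC)).1
        ((hIe _).1 (hmid haC hbC')).2 ?_) hq1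
      · rw [Finset.mem_filter] at hx
        exact hA' x hx.1 hx.2
      · rw [Finset.mem_filter] at hx
        rw [← hIb]
        have := (hA x).1 hx.1
        rwa [hx.2, Int.cast_add, Int.cast_natCast] at this
      · intro x hx y hy h
        simp only [Finset.coe_filter, Set.mem_ofPred_eq] at hx hy
        exact Prod.ext h (hx.2.trans hy.2.symm)
      · intro x hx y hy h
        simp only [Finset.coe_filter, Set.mem_ofPred_eq] at hx hy
        exact Prod.ext h (hx.2.trans hy.2.symm)
      · intro x hx y hy h
        rw [Finset.mem_filter] at hx hy
        exact hN x hx.1 y hy.1 h (by simpa using dvd_sub hx.2 hy.2)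
      · intro x hx n hn
        rw [Finset.mem_filter] at hx
        have hn' : (q : ℤ) ∣ x.1 - n := by rw [← neg_sub]; exact hn.neg_right
        refine ⟨fun h => ?_, fun h => ?_⟩
        · rw [← hIa] at h
          exact hNA x hx.1 (n, t) ((hA (n, t)).2 h) hn' hx.2
        · rw [← hIe] at h
          -- Only heights modulo q matter for N, so row t + q of C also has to be avoided.
          refine hNA x hx.1 (n, t + q) ((hA (n, t + q)).2 (by push_cast; exact h)) hn' ?_
          rw [← sub_sub]
          exact dvd_sub_self_right.2 hx.2
    · push Not at hrow
      have hA0 : ∀ x ∈ A, F (Sum.inl x) = t → x.2 = t := fun x hx h =>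
        (hFA x hx t h).resolve_right (hrow x hx)
      -- The row of A is the interval labelled `none`; each missed residue is a one-point interval
      -- of its own.
      refine card_le_of_rows _ (Sum.elim (fun _ => none) some : _ → Option (ℤ × ℤ))
        (Sum.elim (fun x => x.1) (fun x => x.1)) q q₁ hq (hq2.trans hq1) ?_ ?_ ?_ ?_
      · rintro (x | x) hx (y | y) hy h h' <;>
          simp only [Finset.mem_filter, Finset.inl_mem_disjSum, Finset.inr_mem_disjSum,
            Sum.elim_inl, Sum.elim_inr, reduceCtorEq, Option.some.injEq] at hx hy h h'
        · rw [Prod.ext h' ((hA0 x hx.1 hx.2).trans (hA0 y hy.1 hy.2).symm)]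
        · rw [h]
      · rintro (x | x) hx (y | y) hy h z hz hz' <;>
          simp only [Finset.mem_filter, Finset.inl_mem_disjSum, Finset.inr_mem_disjSum,
            Sum.elim_inl, Sum.elim_inr, reduceCtorEq, Option.some.injEq] at hx hy h hz hz'
        · have hxt := hA0 x hx.1 hx.2
          have hyt := hA0 y hy.1 hy.2
          have hxC := (hA x).1 hx.1
          have hyC := (hA y).1 hy.1
          rw [hxt] at hxC
          rw [hyt] at hyC
          obtain ⟨a, a', -, hI⟩ := exists_row_eq_Icc hC hconv ⟨_, hxC⟩
          have hzC : ((z : ℝ), (t : ℝ)) ∈ C := by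
            rw [hI] at hxC hyC ⊢
            have h3 : (x.1 : ℝ) ≤ z := by exact_mod_cast hz
            have h4 : (z : ℝ) ≤ y.1 := by exact_mod_cast hz'
            exact ⟨hxC.1.trans h3, h4.trans hyC.2⟩
          refine ⟨Sum.inl (z, t), ?_, rfl, rfl⟩
          simp only [Finset.mem_filter, Finset.inl_mem_disjSum]
          refine ⟨(hA (z, t)).2 hzC, ?_⟩
          have h3 := hx.2
          simp only [F, Sum.elim_inl, hxt] at h3 ⊢
          exact h3
        · refine ⟨Sum.inr x, ?_, rfl, ?_⟩
          · simpa only [Finset.mem_filter, Finset.inr_mem_disjSum] using hx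
          · rw [h] at hz ⊢
            exact le_antisymm hz hz'
      · rintro (x | x) hx (y | y) hy h hd <;>
          simp only [Finset.mem_filter, Finset.inl_mem_disjSum, Finset.inr_mem_disjSum,
            Sum.elim_inl, Sum.elim_inr, reduceCtorEq, Option.some.injEq, ne_eq, not_true_eq_false]
            at hx hy h hd
        · refine hNA y hy.1 x hx.1 (by rw [← neg_sub]; exact hd.neg_right) ?_
          rw [hA0 x hx.1 hx.2]
          exact hFN y t hy.2
        · refine hNA x hx.1 y hy.1 hd ?_
          rw [hA0 y hy.1 hy.2]
          exact hFN x t hx.2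
        · refine h (hN x hx.1 y hy.1 hd ?_)
          simpa using dvd_sub (hFN x t hx.2) (hFN y t hy.2)
      · rintro (x | x) hx (y | y) hy h h' <;>
          simp only [Finset.mem_filter, Finset.inl_mem_disjSum, Finset.inr_mem_disjSum,
            Sum.elim_inl, Sum.elim_inr, reduceCtorEq, Option.some.injEq] at hx hy h h'
        · have := h1 _ ((hA y).1 hy.1) _ ((hA x).1 hx.1) 1 (by simp [h'])
            (by simp only [hA0 x hx.1 hx.2, hA0 y hy.1 hy.2])
          omega
        · rw [h] at h'
          omega
  have := Finset.card_le_mul_card_image_of_maps_to hmaps q₁ hfib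
  simpa [Finset.card_disjSum] using this

/-! ### Layers modulo q in dimension three -/

/-- Two closed geodesics of non-parallel directions on a torus meet. -/
theorem exists_geodesic_crossing {X : ℝ × ℝ} {v w : ℤ × ℤ} (h : v.1 * w.2 - v.2 * w.1 ≠ 0) :
    ∃ s r : ℝ, 0 ≤ s ∧ s ≤ 1 ∧ 0 ≤ r ∧ r ≤ 1 ∧ ∃ a b : ℤ,
      X.1 + s * v.1 - r * w.1 = a ∧ X.2 + s * v.2 - r * w.2 = b := by
  have hD : (v.1 * w.2 - v.2 * w.1 : ℝ) ≠ 0 := by exact_mod_cast h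
  set D : ℝ := v.1 * w.2 - v.2 * w.1 with hDdef
  set α : ℝ := (X.1 * w.2 - X.2 * w.1) / D with hα
  set β : ℝ := (v.1 * X.2 - v.2 * X.1) / D with hβ
  have e1 : X.1 = α * v.1 + β * w.1 := by
    rw [hα, hβ, div_mul_eq_mul_div, div_mul_eq_mul_div, ← add_div, eq_div_iff hD, hDdef]
    ring
  have e2 : X.2 = α * v.2 + β * w.2 := by
    rw [hα, hβ, div_mul_eq_mul_div, div_mul_eq_mul_div, ← add_div, eq_div_iff hD, hDdef]
    ring
  -- With X = αv + βw, moving by s along v and by -r along w rounds α up and β down.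
  refine ⟨⌈α⌉ - α, β - ⌊β⌋, sub_nonneg.2 (Int.le_ceil α), by linarith [Int.ceil_lt_add_one α],
    sub_nonneg.2 (Int.floor_le β), by linarith [Int.lt_floor_add_one β],
    ⌈α⌉ * v.1 + ⌊β⌋ * w.1, ⌈α⌉ * v.2 + ⌊β⌋ * w.2, ?_, ?_⟩
  · rw [e1]; push_cast; ring
  · rw [e2]; push_cast; ring

theorem Convex.segment_mem_layer {C : Set ((ℝ × ℝ) × ℝ)} (hconv : Convex ℝ C) {x y x' y' z s : ℝ}
    (h : ((x, y), z) ∈ C) (h' : ((x', y'), z) ∈ C) (h0 : 0 ≤ s) (h1 : s ≤ 1) :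
    ((x + s * (x' - x), y + s * (y' - y)), z) ∈ C := by
  have := hconv h h' (sub_nonneg.2 h1) h0 (by ring)
  convert this using 1
  simp only [Prod.smul_mk, smul_eq_mul, Prod.mk_add_mk, Prod.mk.injEq]
  refine ⟨⟨?_, ?_⟩, ?_⟩ <;> ring

/-- In a convex set whose layers at heights congruent modulo `q` are disjoint modulo `q`, chords of
different such layers along multiples by `q` of integer vectors are parallel. -/
theorem det_eq_zero_of_layers {C : Set ((ℝ × ℝ) × ℝ)} (hconv : Convex ℝ C) {q : ℕ} (hq : 0 < q)
    (h3 : ∀ p ∈ C, ∀ p' ∈ C, ∀ a b c : ℤ, p.1.1 - p'.1.1 = q * a → p.1.2 - p'.1.2 = q * b →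
      p.2 - p'.2 = q * c → c = 0)
    {P Q v w : ℤ × ℤ} {z z' : ℤ} (hz : z ≠ z') (hzz : (q : ℤ) ∣ z - z')
    (hP : (((P.1 : ℝ), (P.2 : ℝ)), (z : ℝ)) ∈ C)
    (hP' : ((((P.1 + q * v.1 : ℤ) : ℝ), ((P.2 + q * v.2 : ℤ) : ℝ)), (z : ℝ)) ∈ C)
    (hQ : (((Q.1 : ℝ), (Q.2 : ℝ)), (z' : ℝ)) ∈ C)
    (hQ' : ((((Q.1 + q * w.1 : ℤ) : ℝ), ((Q.2 + q * w.2 : ℤ) : ℝ)), (z' : ℝ)) ∈ C) :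
    v.1 * w.2 - v.2 * w.1 = 0 := by
  by_contra h
  have hqR : (q : ℝ) ≠ 0 := by exact_mod_cast hq.ne'
  obtain ⟨s, r, hs0, hs1, hr0, hr1, a, b, ha, hb⟩ :=
    exists_geodesic_crossing (X := ((P.1 - Q.1) / q, (P.2 - Q.2) / q)) h
  obtain ⟨c, hc⟩ := hzz
  have hm := hconv.segment_mem_layer hP hP' hs0 hs1
  have hm' := hconv.segment_mem_layer hQ hQ' hr0 hr1
  have hc0 := h3 _ hm _ hm' a b c ?_ ?_ ?_
  · rw [hc0, mul_zero, sub_eq_zero] at hc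
    exact hz hc
  · rw [← ha]; push_cast; field_simp; ring
  · rw [← hb]; push_cast; field_simp; ring
  · simp only; exact_mod_cast hc

/-- The lattice points of a convex set in a class of layers modulo `q`, when all coincidences
modulo `q` within layers are along one primitive direction. -/
theorem card_layers_le_of_parallel {C : Set ((ℝ × ℝ) × ℝ)} (hconv : Convex ℝ C) {q q₁ : ℕ}
    (hq : 0 < q) (hq1 : q ≤ q₁)
    (h1 : ∀ p p' : ℝ × ℝ, ∀ z : ℝ, (p, z) ∈ C → (p', z) ∈ C → ∀ a b : ℤ,
      p.1 - p'.1 = q₁ * a → p.2 - p'.2 = q₁ * b → a = 0 ∧ b = 0)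
    (B : Finset ((ℤ × ℤ) × ℤ)) (hB : ∀ x ∈ B, (((x.1.1 : ℝ), (x.1.2 : ℝ)), (x.2 : ℝ)) ∈ C)
    (hB' : ∀ x ∈ B, ∀ p : ℤ × ℤ, (((p.1 : ℝ), (p.2 : ℝ)), (x.2 : ℝ)) ∈ C → (p, x.2) ∈ B)
    (hlayer : ∀ x ∈ B, ∀ y ∈ B, (q : ℤ) ∣ x.1.1 - y.1.1 → (q : ℤ) ∣ x.1.2 - y.1.2 → x.2 = y.2)
    {v₁ v₂ : ℤ} (hv : IsCoprime v₁ v₂)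
    (hpar : ∀ x ∈ B, ∀ y ∈ B, x.2 = y.2 → ∀ a b : ℤ, x.1.1 - y.1.1 = q * a →
      x.1.2 - y.1.2 = q * b → v₁ * b - v₂ * a = 0) : B.card ≤ q₁ * q := by
  obtain ⟨m, n, hmn⟩ := hv
  -- As m v₁ + n v₂ = 1, the pair (σ, τ) is a unimodular change of coordinates: τ labels the lines
  -- of direction v and σ is the position on the line.
  let τ : (ℤ × ℤ) × ℤ → ℤ := fun x => v₁ * x.1.2 - v₂ * x.1.1
  let σ : (ℤ × ℤ) × ℤ → ℤ := fun x => m * x.1.1 + n * x.1.2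
  have hx1 : ∀ x, x.1.1 = σ x * v₁ - τ x * n := fun x => by
    simp only [σ, τ]; linear_combination (-x.1.1) * hmn
  have hx2 : ∀ x, x.1.2 = σ x * v₂ + τ x * m := fun x => by
    simp only [σ, τ]; linear_combination (-x.1.2) * hmn
  have hq₁ : q₁ ≠ 0 := by omega
  have hmaps : ∀ x ∈ B, τ x % q ∈ Finset.Ico (0 : ℤ) q := fun x _ => by
    rw [Finset.mem_Ico]
    exact ⟨Int.emod_nonneg _ (by omega), Int.emod_lt_of_pos _ (by omega)⟩
  have key := Finset.card_le_mul_card_image_of_maps_to hmaps q₁ ?_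
  · simpa using key
  intro c _
  refine card_le_of_rows _ (fun x => (τ x, x.2)) σ q q₁ hq hq1 ?_ ?_ ?_ ?_
  · intro x _ y _ h h'
    rw [Prod.mk.injEq] at h
    refine Prod.ext (Prod.ext ?_ ?_) h.2
    · rw [hx1 x, hx1 y, h.1, h']
    · rw [hx2 x, hx2 y, h.1, h']
  · intro x hx y hy h k hk hk'
    rw [Finset.mem_filter] at hx hy
    rw [Prod.mk.injEq] at h
    have hpt : (((k * v₁ - τ x * n : ℤ), (k * v₂ + τ x * m : ℤ)), x.2) ∈ B := by
      refine hB' x hx.1 (k * v₁ - τ x * n, k * v₂ + τ x * m) ?_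
      rcases (hk.trans hk').eq_or_lt with heq | hlt
      · have : k = σ x := by omega
        rw [this, ← hx1, ← hx2]
        exact hB x hx.1
      · have hltR : (0 : ℝ) < σ y - σ x := by
          have : (σ x : ℝ) < σ y := by exact_mod_cast hlt
          linarith
        have hkR : (σ x : ℝ) ≤ k := by exact_mod_cast hk
        have hkR' : (k : ℝ) ≤ σ y := by exact_mod_cast hk'
        have hyC := hB y hy.1
        rw [← h.2] at hyC
        have := hconv.segment_mem_layer (s := (k - σ x) / (σ y - σ x)) (hB x hx.1) hyC
          (div_nonneg (by linarith) hltR.le) ((div_le_one hltR).2 (by linarith))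
        have e1 : (y.1.1 : ℝ) - x.1.1 = (σ y - σ x) * v₁ := by
          rw [hx1 x, hx1 y, h.1]; push_cast; ring
        have e2 : (y.1.2 : ℝ) - x.1.2 = (σ y - σ x) * v₂ := by
          rw [hx2 x, hx2 y, h.1]; push_cast; ring
        rw [e1, e2, ← mul_assoc, ← mul_assoc, div_mul_cancel₀ _ hltR.ne', hx1 x, hx2 x] at this
        convert this using 3 <;> push_cast <;> ring
    have hτ : τ (((k * v₁ - τ x * n : ℤ), (k * v₂ + τ x * m : ℤ)), x.2) = τ x := by
      show v₁ * (k * v₂ + τ x * m) - v₂ * (k * v₁ - τ x * n) = τ x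
      linear_combination τ x * hmn
    refine ⟨_, Finset.mem_filter.2 ⟨hpt, by rw [hτ]; exact hx.2⟩, by rw [hτ], ?_⟩
    show m * (k * v₁ - τ x * n) + n * (k * v₂ + τ x * m) = k
    linear_combination k * hmn
  -- Here τ agrees modulo q within the class; if σ does too, the points are congruent modulo q,
  -- hence in one layer, and parallelism forces equal τ.
  · intro x hx y hy h hd
    rw [Finset.mem_filter] at hx hy
    have hτ : (q : ℤ) ∣ τ x - τ y := Int.ModEq.dvd (hy.2.trans hx.2.symm)
    obtain ⟨k, hk⟩ := hτ
    obtain ⟨l, hl⟩ := hd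
    have e1 : x.1.1 - y.1.1 = q * (l * v₁ - k * n) := by
      rw [hx1 x, hx1 y]; linear_combination v₁ * hl - n * hk
    have e2 : x.1.2 - y.1.2 = q * (l * v₂ + k * m) := by
      rw [hx2 x, hx2 y]; linear_combination v₂ * hl + m * hk
    have hz := hlayer x hx.1 y hy.1 ⟨_, e1⟩ ⟨_, e2⟩
    have := hpar x hx.1 y hy.1 hz _ _ e1 e2
    have hk0 : k = 0 := by linear_combination this - k * hmn
    rw [hk0, mul_zero, sub_eq_zero] at hk
    exact h (Prod.ext hk hz)
  · intro x hx y hy h h'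
    rw [Finset.mem_filter] at hx hy
    rw [Prod.mk.injEq] at h
    have hxC := hB x hx.1
    rw [h.2] at hxC
    have := h1 _ _ _ (hB y hy.1) hxC v₁ v₂ ?_ ?_
    · rw [this.1, this.2] at hmn
      simp at hmn
    · simp only
      rw [hx1 x, hx1 y, h.1, h']; push_cast; ring
    · simp only
      rw [hx2 x, hx2 y, h.1, h']; push_cast; ring

/-- The lattice points of a three-dimensional convex body in a class of layers modulo `q`. -/
theorem card_layers_le {C : Set ((ℝ × ℝ) × ℝ)} (hC : IsCompact C) (hconv : Convex ℝ C)
    {q q₂ q₁ : ℕ} (hq : 0 < q) (hq2 : q ≤ q₂) (hq1 : q₂ ≤ q₁)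
    (h3 : ∀ p ∈ C, ∀ p' ∈ C, ∀ a b c : ℤ, p.1.1 - p'.1.1 = q * a → p.1.2 - p'.1.2 = q * b →
      p.2 - p'.2 = q * c → c = 0)
    (h2 : ∀ p p' : ℝ × ℝ, ∀ z : ℝ, (p, z) ∈ C → (p', z) ∈ C → ∀ a b : ℤ,
      p.1 - p'.1 = q₂ * a → p.2 - p'.2 = q₂ * b → b = 0)
    (h1 : ∀ p p' : ℝ × ℝ, ∀ z : ℝ, (p, z) ∈ C → (p', z) ∈ C → ∀ a b : ℤ,
      p.1 - p'.1 = q₁ * a → p.2 - p'.2 = q₁ * b → a = 0 ∧ b = 0)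
    (hheight : ∀ p p' : ℝ × ℝ, ∀ z : ℝ, (p, z) ∈ C → (p', z) ∈ C → p.2 - p'.2 < 2 * q₂)
    (B : Finset ((ℤ × ℤ) × ℤ)) (hB : ∀ x ∈ B, (((x.1.1 : ℝ), (x.1.2 : ℝ)), (x.2 : ℝ)) ∈ C)
    (hB' : ∀ x ∈ B, ∀ p : ℤ × ℤ, (((p.1 : ℝ), (p.2 : ℝ)), (x.2 : ℝ)) ∈ C → (p, x.2) ∈ B)
    (hBq : ∀ x ∈ B, ∀ y ∈ B, (q : ℤ) ∣ x.2 - y.2) : B.card ≤ q₁ * q₂ := by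
  have hlayer : ∀ x ∈ B, ∀ y ∈ B, (q : ℤ) ∣ x.1.1 - y.1.1 → (q : ℤ) ∣ x.1.2 - y.1.2 →
      x.2 = y.2 := by
    rintro x hx y hy ⟨a, ha⟩ ⟨b, hb⟩
    obtain ⟨c, hc⟩ := hBq x hx y hy
    have := h3 _ (hB x hx) _ (hB y hy) a b c (by simp only; exact_mod_cast ha)
      (by simp only; exact_mod_cast hb) (by simp only; exact_mod_cast hc)
    rwa [this, mul_zero, sub_eq_zero] at hc
  have hcross : ∀ x ∈ B, ∀ y ∈ B, x.2 = y.2 → ∀ x' ∈ B, ∀ y' ∈ B, x'.2 = y'.2 → x.2 ≠ x'.2 →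
      ∀ a b a' b' : ℤ, x.1.1 - y.1.1 = q * a → x.1.2 - y.1.2 = q * b → x'.1.1 - y'.1.1 = q * a' →
      x'.1.2 - y'.1.2 = q * b' → a * b' - b * a' = 0 := by
    intro x hx y hy hxy x' hx' y' hy' hxy' hne a b a' b' ha hb ha' hb'
    refine det_eq_zero_of_layers hconv hq h3 (P := y.1) (Q := y'.1) (v := (a, b)) (w := (a', b'))
      (z := y.2) (z' := y'.2) (by rwa [← hxy, ← hxy']) (hBq y hy y' hy') (hB y hy) ?_ (hB y' hy') ?_
    · simp only
      rw [← ha, ← hb, ← hxy, add_sub_cancel, add_sub_cancel]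
      exact hB x hx
    · simp only
      rw [← ha', ← hb', ← hxy', add_sub_cancel, add_sub_cancel]
      exact hB x' hx'
  -- Do two different layers each contain a pair of distinct points congruent modulo q?
  by_cases htwo : ∃ x ∈ B, ∃ y ∈ B, ∃ x' ∈ B, ∃ y' ∈ B, x ≠ y ∧ x' ≠ y' ∧ x.2 ≠ x'.2 ∧
      ((q : ℤ) ∣ x.1.1 - y.1.1 ∧ (q : ℤ) ∣ x.1.2 - y.1.2) ∧
      ((q : ℤ) ∣ x'.1.1 - y'.1.1 ∧ (q : ℤ) ∣ x'.1.2 - y'.1.2)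
  · obtain ⟨x, hx, y, hy, x', hx', y', hy', hxy, hxy', hne, ⟨⟨a, ha⟩, b, hb⟩, ⟨a', ha'⟩, b', hb'⟩ :=
      htwo
    have hz := hlayer x hx y hy ⟨a, ha⟩ ⟨b, hb⟩
    have hz' := hlayer x' hx' y' hy' ⟨a', ha'⟩ ⟨b', hb'⟩
    have hab0 : ¬ (a = 0 ∧ b = 0) := by
      rintro ⟨rfl, rfl⟩
      exact hxy (Prod.ext (Prod.ext (by linarith) (by linarith)) hz)
    have hab0' : ¬ (a' = 0 ∧ b' = 0) := by
      rintro ⟨rfl, rfl⟩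
      exact hxy' (Prod.ext (Prod.ext (by linarith) (by linarith)) hz')
    have hdet := hcross x hx y hy hz x' hx' y' hy' hz' hne a b a' b' ha hb ha' hb'
    have hpar : ∀ u ∈ B, ∀ w ∈ B, u.2 = w.2 → ∀ c d : ℤ, u.1.1 - w.1.1 = q * c →
        u.1.2 - w.1.2 = q * d → a * d - b * c = 0 := by
      intro u hu w hw huw c d hc hd
      by_cases hux : x.2 = u.2
      · have h5 := hcross u hu w hw huw x' hx' y' hy' hz' (by rwa [← hux]) c d a' b' hc hd ha' hb'
        by_contra h6
        refine hab0' ⟨?_, ?_⟩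
        · refine (mul_eq_zero.1 (?_ : (a * d - b * c) * a' = 0)).resolve_left h6
          linear_combination (-a) * h5 + c * hdet
        · refine (mul_eq_zero.1 (?_ : (a * d - b * c) * b' = 0)).resolve_left h6
          linear_combination (-b) * h5 + d * hdet
      · exact hcross x hx y hy hz u hu w hw huw hux a b c d ha hb hc hd
    have hgpos : 0 < Int.gcd a b := by
      rw [Nat.pos_iff_ne_zero, Ne, Int.gcd_eq_zero_iff]
      exact hab0
    obtain ⟨v₁, v₂, hg, hv₁, hv₂⟩ := Int.exists_gcd_one hgpos
    refine (card_layers_le_of_parallel hconv hq (hq2.trans hq1) h1 B hB hB' hlayer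
      (Int.isCoprime_iff_gcd_eq_one.2 hg) ?_).trans (Nat.mul_le_mul_left _ hq2)
    intro u hu w hw huw c d hc hd
    have h5 := hpar u hu w hw huw c d hc hd
    have hgne : ((Int.gcd a b : ℕ) : ℤ) ≠ 0 := by exact_mod_cast hgpos.ne'
    refine (mul_eq_zero.1 (?_ : (v₁ * d - v₂ * c) * (Int.gcd a b : ℤ) = 0)).resolve_right hgne
    linear_combination h5 - d * hv₁ + c * hv₂
  -- z₀ is the only height where residues can repeat; any value, here 0, serves if none repeat.
  · obtain ⟨z₀, hz₀⟩ : ∃ z₀ : ℤ, ∀ x ∈ B, ∀ y ∈ B, x.2 ≠ z₀ → (q : ℤ) ∣ x.1.1 - y.1.1 →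
        (q : ℤ) ∣ x.1.2 - y.1.2 → x = y := by
      by_cases hone : ∃ x ∈ B, ∃ y ∈ B, x ≠ y ∧ (q : ℤ) ∣ x.1.1 - y.1.1 ∧ (q : ℤ) ∣ x.1.2 - y.1.2
      · obtain ⟨x, hx, y, hy, hxy, hd⟩ := hone
        refine ⟨x.2, fun x' hx' y' hy' hne h4 h5 => ?_⟩
        by_contra h6
        exact htwo ⟨x, hx, y, hy, x', hx', y', hy', hxy, h6, hne.symm, hd, h4, h5⟩
      · refine ⟨0, fun x' hx' y' hy' _ h4 h5 => ?_⟩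
        by_contra h6
        exact hone ⟨x', hx', y', hy', h6, h4, h5⟩
    set A : Finset (ℤ × ℤ) := (B.filter fun x => x.2 = z₀).image Prod.fst with hAdef
    set N : Finset (ℤ × ℤ) := (B.filter fun x => x.2 ≠ z₀).image Prod.fst with hNdef
    have hAcard : A.card = (B.filter fun x => x.2 = z₀).card := by
      refine Finset.card_image_of_injOn fun x hx y hy h => ?_
      simp only [Finset.coe_filter, Set.mem_ofPred_eq] at hx hy
      exact Prod.ext h (hx.2.trans hy.2.symm)
    have hNcard : N.card = (B.filter fun x => x.2 ≠ z₀).card := by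
      refine Finset.card_image_of_injOn fun x hx y hy h => ?_
      simp only [Finset.coe_filter, Set.mem_ofPred_eq] at hx hy
      exact hz₀ x hx.1 y hy.1 hx.2 (by simp [h]) (by simp [h])
    rw [← Finset.card_filter_add_card_filter_not (s := B) (fun x => x.2 = z₀), ← hAcard, ← hNcard]
    by_cases hA0 : ∃ x₀ ∈ B, x₀.2 = z₀
    · obtain ⟨x₀, hx₀, rfl⟩ := hA0
      have hemb : Topology.IsClosedEmbedding fun p : ℝ × ℝ => (p, (x₀.2 : ℝ)) :=
        Topology.IsClosedEmbedding.of_continuous_injective_isClosedMap (by fun_prop)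
          (fun a b h => by simpa using h) (isClosedMap_prodMk_right _)
      refine card_planar_add_card_missing_le (C := {p | (p, (x₀.2 : ℝ)) ∈ C})
        (hemb.isCompact_preimage hC) ?_ hq hq2 hq1 (fun p hp p' hp' => h2 p p' _ hp hp')
        (fun p hp p' hp' a ha hp2 => (h1 p p' _ hp hp' a 0 ha (by simp [hp2])).1)
        (fun p hp p' hp' => hheight p p' _ hp hp') A N ?_ ?_ ?_
      · rintro ⟨x, y⟩ hx ⟨x', y'⟩ hy u v hu hv huv
        have := hconv.segment_mem_layer hx hy hv (by linarith)
        have hu' : u = 1 - v := by linarith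
        subst hu'
        simp only [Prod.smul_mk, smul_eq_mul, Prod.mk_add_mk, Set.mem_ofPred_eq]
        convert this using 3 <;> ring
      · intro p
        simp only [hAdef, Finset.mem_image, Finset.mem_filter, Set.mem_ofPred_eq]
        constructor
        · rintro ⟨x, ⟨hx, hxz⟩, rfl⟩
          rw [← hxz]
          exact hB x hx
        · intro hp
          exact ⟨(p, x₀.2), ⟨hB' x₀ hx₀ p hp, rfl⟩, rfl⟩
      · intro m hm n hn hd hd'
        simp only [hNdef, Finset.mem_image, Finset.mem_filter] at hm hn
        obtain ⟨x, ⟨hx, hxz⟩, rfl⟩ := hm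
        obtain ⟨y, ⟨hy, -⟩, rfl⟩ := hn
        rw [hz₀ x hx y hy hxz hd hd']
      · intro m hm n hn hd hd'
        simp only [hNdef, hAdef, Finset.mem_image, Finset.mem_filter] at hm hn
        obtain ⟨x, ⟨hx, hxz⟩, rfl⟩ := hm
        obtain ⟨y, ⟨hy, hyz⟩, rfl⟩ := hn
        exact hxz ((hlayer x hx y hy hd hd').trans hyz)
    · have hAe : A = ∅ := by
        rw [hAdef, Finset.image_eq_empty, Finset.filter_eq_empty_iff]
        exact fun x hx h => hA0 ⟨x, hx, h⟩
      rw [hAe]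
      -- With no layer at z₀, the planar count applies to the empty section.
      refine card_planar_add_card_missing_le isCompact_empty convex_empty hq hq2 hq1 (by simp)
        (by simp) (by simp) ∅ N (by simp) ?_ (by simp)
      intro m hm n hn hd hd'
      simp only [hNdef, Finset.mem_image, Finset.mem_filter] at hm hn
      obtain ⟨x, ⟨hx, hxz⟩, rfl⟩ := hm
      obtain ⟨y, ⟨hy, -⟩, rfl⟩ := hn
      rw [hz₀ x hx y hy hxz hd hd']

/-- The lattice points of a three-dimensional convex body satisfying packing conditions at scales
`q₁ ≥ q₂ ≥ q₃` along a flag. -/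
theorem card_le_of_packing {C : Set ((ℝ × ℝ) × ℝ)} (hC : IsCompact C) (hconv : Convex ℝ C)
    {q q₂ q₁ : ℕ} (hq : 0 < q) (hq2 : q ≤ q₂) (hq1 : q₂ ≤ q₁)
    (h3 : ∀ p ∈ C, ∀ p' ∈ C, ∀ a b c : ℤ, p.1.1 - p'.1.1 = q * a → p.1.2 - p'.1.2 = q * b →
      p.2 - p'.2 = q * c → c = 0)
    (h2 : ∀ p p' : ℝ × ℝ, ∀ z : ℝ, (p, z) ∈ C → (p', z) ∈ C → ∀ a b : ℤ,
      p.1 - p'.1 = q₂ * a → p.2 - p'.2 = q₂ * b → b = 0)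
    (h1 : ∀ p p' : ℝ × ℝ, ∀ z : ℝ, (p, z) ∈ C → (p', z) ∈ C → ∀ a b : ℤ,
      p.1 - p'.1 = q₁ * a → p.2 - p'.2 = q₁ * b → a = 0 ∧ b = 0)
    (hheight : ∀ p p' : ℝ × ℝ, ∀ z : ℝ, (p, z) ∈ C → (p', z) ∈ C → p.2 - p'.2 < 2 * q₂)
    (A : Finset ((ℤ × ℤ) × ℤ))
    (hA : ∀ x, x ∈ A ↔ (((x.1.1 : ℝ), (x.1.2 : ℝ)), (x.2 : ℝ)) ∈ C) :
    A.card ≤ q₁ * q₂ * q := by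
  have hmaps : ∀ x ∈ A, x.2 % q ∈ Finset.Ico (0 : ℤ) q := fun x _ => by
    rw [Finset.mem_Ico]
    exact ⟨Int.emod_nonneg _ (by omega), Int.emod_lt_of_pos _ (by omega)⟩
  have key := Finset.card_le_mul_card_image_of_maps_to hmaps (q₁ * q₂) ?_
  · simpa using key
  intro c _
  refine card_layers_le hC hconv hq hq2 hq1 h3 h2 h1 hheight _ ?_ ?_ ?_
  · intro x hx
    rw [Finset.mem_filter] at hx
    exact (hA x).1 hx.1
  · intro x hx p hp
    rw [Finset.mem_filter] at hx ⊢
    exact ⟨(hA (p, x.2)).2 hp, hx.2⟩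
  · intro x hx y hy
    rw [Finset.mem_filter] at hx hy
    exact Int.ModEq.dvd (hy.2.trans hx.2.symm)

/-! ### Dilates of symmetric bodies -/

/-- A compact convex set, symmetric about the origin, which is an interior point. -/
structure IsSymmetricBody {E : Type*} [NormedAddCommGroup E] [NormedSpace ℝ E] (K : Set E) :
    Prop where
  isCompact : IsCompact K
  convex : Convex ℝ K
  neg_mem : ∀ x ∈ K, -x ∈ K
  zero_mem_interior : (0 : E) ∈ interior K

namespace IsSymmetricBody

variable {E : Type*} [NormedAddCommGroup E] [NormedSpace ℝ E] {K : Set E}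

theorem zero_mem (hK : IsSymmetricBody K) : (0 : E) ∈ K := interior_subset hK.zero_mem_interior

theorem smul_mem_of_abs_le (hK : IsSymmetricBody K) {x : E} (hx : x ∈ K) {c : ℝ} (hc : |c| ≤ 1) :
    c • x ∈ K := by
  obtain ⟨h1, h2⟩ := abs_le.1 hc
  rcases le_total 0 c with h | h
  · exact hK.convex.smul_mem_of_zero_mem hK.zero_mem hx ⟨h, h2⟩
  · have := hK.convex.smul_mem_of_zero_mem hK.zero_mem (hK.neg_mem x hx)
      (t := -c) ⟨by linarith, by linarith⟩
    simpa using this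

theorem smul_mem_smul (hK : IsSymmetricBody K) {x : E} {r s c : ℝ} (hx : x ∈ r • K) (hs : 0 < s)
    (h : |c * r| ≤ s) : c • x ∈ s • K := by
  obtain ⟨y, hy, rfl⟩ := Set.mem_smul_set.1 hx
  refine Set.mem_smul_set.2 ⟨(c * r / s) • y, hK.smul_mem_of_abs_le hy ?_, ?_⟩
  · rw [abs_div, abs_of_pos hs]
    exact (div_le_one hs).2 h
  · rw [smul_smul, smul_smul, mul_div_cancel₀ _ hs.ne']

theorem smul_mono (hK : IsSymmetricBody K) {r s : ℝ} (hr : 0 < r) (hrs : r ≤ s) :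
    r • K ⊆ s • K := fun x hx => by
  simpa using hK.smul_mem_smul (c := 1) hx (hr.trans_le hrs) (by rwa [one_mul, abs_of_pos hr])

theorem sub_mem_smul (hK : IsSymmetricBody K) {x y : E} (hx : x ∈ K) (hy : y ∈ K) :
    x - y ∈ (2 : ℝ) • K := by
  refine Set.mem_smul_set.2 ⟨(1 / 2 : ℝ) • x + (1 / 2 : ℝ) • -y,
    hK.convex hx (hK.neg_mem y hy) (by norm_num) (by norm_num) (by norm_num), ?_⟩
  rw [smul_add, smul_smul, smul_smul]
  norm_num [sub_eq_add_neg]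

theorem mem_smul_iff_gauge_le (hK : IsSymmetricBody K) {x : E} {r : ℝ} (hr : 0 < r) :
    x ∈ r • K ↔ gauge K x ≤ r := by
  have h1 := gauge_le_one_iff_mem_closure (x := r⁻¹ • x) hK.convex
    (mem_interior_iff_mem_nhds.1 hK.zero_mem_interior)
  rw [hK.isCompact.isClosed.closure_eq, gauge_smul_of_nonneg (inv_nonneg.2 hr.le), smul_eq_mul,
    inv_mul_le_one₀ hr] at h1
  rw [h1, Set.mem_smul_set_iff_inv_smul_mem₀ hr.ne']

theorem exists_mem_smul (hK : IsSymmetricBody K) (x : E) : ∃ r : ℝ, 0 < r ∧ x ∈ r • K := by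
  refine ⟨gauge K x + 1, by linarith [gauge_nonneg (s := K) x], ?_⟩
  rw [hK.mem_smul_iff_gauge_le (by linarith [gauge_nonneg (s := K) x])]
  linarith

end IsSymmetricBody

theorem finite_inter_lattice {E : Type*} [NormedAddCommGroup E] [NormedSpace ℝ E]
    [FiniteDimensional ℝ E] (Λ : Submodule ℤ E) [DiscreteTopology Λ] {s : Set E}
    (hs : Bornology.IsBounded s) : (s ∩ (Λ : Set E)).Finite := by
  have : ProperSpace E := FiniteDimensional.proper ℝ E
  change (s ∩ Λ.toAddSubgroup).Finite
  have : DiscreteTopology Λ.toAddSubgroup := (inferInstance : DiscreteTopology Λ)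
  exact Metric.finite_isBounded_inter_isClosed DiscreteTopology.isDiscrete hs
    AddSubgroup.isClosed_of_discrete

/-- A dilate contains finitely many lattice points, so the gauge attains its minimum over those
outside U. Stating minimality through dilates matches the definition of the successive minima. -/
theorem exists_lattice_minimizer {E : Type*} [NormedAddCommGroup E] [NormedSpace ℝ E]
    [FiniteDimensional ℝ E] {K : Set E} (hK : IsSymmetricBody K) (Λ : Submodule ℤ E)
    [DiscreteTopology Λ] (U : Submodule ℝ E) (h : ∃ x ∈ Λ, x ∉ U) :
    ∃ v ∈ Λ, v ∉ U ∧ ∀ x ∈ Λ, x ∉ U → ∀ r : ℝ, 0 < r → x ∈ r • K → v ∈ r • K := by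
  obtain ⟨x₀, hx₀, hx₀U⟩ := h
  obtain ⟨r₀, hr₀, hxr₀⟩ := hK.exists_mem_smul x₀
  have hfin : {x | x ∈ r₀ • K ∩ (Λ : Set E) ∧ x ∉ U}.Finite :=
    (finite_inter_lattice Λ (hK.isCompact.smul r₀).isBounded).subset fun x hx => hx.1
  obtain ⟨v, hv, hmin⟩ := Set.exists_min_image _ (gauge K) hfin ⟨x₀, ⟨hxr₀, hx₀⟩, hx₀U⟩
  refine ⟨v, hv.1.2, hv.2, fun x hx hxU r hr hxr => ?_⟩
  rcases le_total r r₀ with hle | hle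
  · have := hmin x ⟨⟨hK.smul_mono hr hle hxr, hx⟩, hxU⟩
    rw [hK.mem_smul_iff_gauge_le hr] at hxr ⊢
    exact this.trans hxr
  · exact hK.smul_mono hr₀ hle hv.1.1

/-! ### Lattice bases adapted to the minima -/

/-- Every lattice point outside of `U` and in a dilate of `K` shares that dilate with lattice points
spanning `U`. -/
def IsMinimaAdapted {E : Type*} [NormedAddCommGroup E] [NormedSpace ℝ E] (K : Set E)
    (Λ : Submodule ℤ E) (U : Submodule ℝ E) : Prop :=
  ∀ x ∈ Λ, x ∉ U → ∀ r : ℝ, 0 < r → x ∈ r • K → U ≤ Submodule.span ℝ (r • K ∩ (Λ : Set E))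

/-- The lattice points in `U` are cobounded in `U`. -/
def IsLatticeSubspace {E : Type*} [NormedAddCommGroup E] [NormedSpace ℝ E]
    (Λ : Submodule ℤ E) (U : Submodule ℝ E) : Prop :=
  ∃ R : ℝ, ∀ u ∈ U, ∃ l ∈ Λ, l ∈ U ∧ ‖u - l‖ ≤ R

theorem isMinimaAdapted_bot {E : Type*} [NormedAddCommGroup E] [NormedSpace ℝ E] (K : Set E)
    (Λ : Submodule ℤ E) : IsMinimaAdapted K Λ ⊥ := fun _ _ _ _ _ _ => bot_le

theorem isLatticeSubspace_bot {E : Type*} [NormedAddCommGroup E] [NormedSpace ℝ E]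
    (Λ : Submodule ℤ E) : IsLatticeSubspace Λ ⊥ :=
  ⟨0, fun u hu => ⟨0, Λ.zero_mem, Submodule.zero_mem _, by simpa using hu⟩⟩

/-- Rounding down the coefficient of e leaves a fractional multiple of e, which costs at most ‖e‖.
-/
theorem IsLatticeSubspace.sup_span_singleton {E : Type*} [NormedAddCommGroup E] [NormedSpace ℝ E]
    {Λ : Submodule ℤ E} {U : Submodule ℝ E} (hU : IsLatticeSubspace Λ U) {e : E} (he : e ∈ Λ) :
    IsLatticeSubspace Λ (U ⊔ Submodule.span ℝ {e}) := by
  obtain ⟨R, hR⟩ := hU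
  refine ⟨R + ‖e‖, fun x hx => ?_⟩
  obtain ⟨u, hu, y, hy, rfl⟩ := Submodule.mem_sup.1 hx
  obtain ⟨c, rfl⟩ := Submodule.mem_span_singleton.1 hy
  obtain ⟨l, hl, hlU, hle⟩ := hR u hu
  refine ⟨l + ⌊c⌋ • e, Λ.add_mem hl (Λ.smul_mem _ he), Submodule.add_mem_sup hlU ?_, ?_⟩
  · rw [← Int.cast_smul_eq_zsmul ℝ]
    exact Submodule.smul_mem _ _ (Submodule.mem_span_singleton_self e)
  · have : u + c • e - (l + ⌊c⌋ • e) = (u - l) + Int.fract c • e := by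
      rw [← Int.cast_smul_eq_zsmul ℝ, Int.fract, sub_smul]; abel
    rw [this]
    refine (norm_add_le _ _).trans (add_le_add hle ?_)
    rw [norm_smul, Real.norm_of_nonneg (Int.fract_nonneg c)]
    exact mul_le_of_le_one_left (norm_nonneg _) (Int.fract_lt_one c).le

theorem IsMinimaAdapted.sup_span_singleton {E : Type*} [NormedAddCommGroup E] [NormedSpace ℝ E]
    {K : Set E} {Λ : Submodule ℤ E} {U : Submodule ℝ E} (hU : IsMinimaAdapted K Λ U) {v : E}
    (hv : v ∈ Λ)
    (hmin : ∀ x ∈ Λ, x ∉ U → ∀ r : ℝ, 0 < r → x ∈ r • K → v ∈ r • K) :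
    IsMinimaAdapted K Λ (U ⊔ Submodule.span ℝ {v}) := by
  intro x hx hxU r hr hxr
  have hxU' : x ∉ U := fun h => hxU (Submodule.mem_sup_left h)
  refine sup_le (hU x hx hxU' r hr hxr) ?_
  rw [Submodule.span_le, Set.singleton_subset_iff]
  exact Submodule.subset_span ⟨hmin x hx hxU' r hr hxr, hv⟩

/-- A lattice vector completing the lattice points of `U` to those of `U ⊔ ℝ v`. -/
theorem exists_primitive_complement {E : Type*} [NormedAddCommGroup E] [NormedSpace ℝ E]
    [FiniteDimensional ℝ E] {Λ : Submodule ℤ E} [DiscreteTopology Λ] {U : Submodule ℝ E}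
    (hU : IsLatticeSubspace Λ U) {v : E} (hv : v ∈ Λ) (hvU : v ∉ U) :
    ∃ e ∈ Λ, e ∉ U ∧ U ⊔ Submodule.span ℝ {e} = U ⊔ Submodule.span ℝ {v} ∧
      ∀ x ∈ Λ, x ∈ U ⊔ Submodule.span ℝ {e} → ∃ n : ℤ, x - n • e ∈ U := by
  obtain ⟨f₀, hf₀, hf₀U⟩ := U.exists_le_ker_of_notMem hvU
  obtain ⟨f, hfv, hfU⟩ : ∃ f : E →ₗ[ℝ] ℝ, f v = 1 ∧ ∀ u ∈ U, f u = 0 :=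
    ⟨(f₀ v)⁻¹ • f₀, by simp [hf₀], fun u hu => by simp [LinearMap.mem_ker.1 (hf₀U hu)]⟩
  have hdecomp : ∀ x ∈ U ⊔ Submodule.span ℝ {v}, x - f x • v ∈ U := by
    intro x hx
    obtain ⟨u, hu, y, hy, rfl⟩ := Submodule.mem_sup.1 hx
    obtain ⟨c, rfl⟩ := Submodule.mem_span_singleton.1 hy
    simpa [hfU u hu, hfv] using hu
  obtain ⟨R, hR⟩ := hU
  set W := U ⊔ Submodule.span ℝ {v} with hW
  have hvW : v ∈ W := Submodule.mem_sup_right (Submodule.mem_span_singleton_self v)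
  have hUW : U ≤ W := le_sup_left
  set F : Set E := {x | x ∈ Metric.closedBall 0 (R + ‖v‖) ∩ (Λ : Set E) ∧ x ∈ W ∧ 0 < f x}
  have hFfin : F.Finite :=
    (finite_inter_lattice Λ Metric.isBounded_closedBall).subset fun x hx => hx.1
  -- Subtracting lattice points of U does not change f and brings x into a fixed ball. So only
  -- finitely many lattice points matter for the least positive value of f, which e attains.
  have hred : ∀ x ∈ Λ, x ∈ W → 0 < f x → f x ≤ 1 → ∃ y ∈ F, f y = f x := by
    intro x hx hxW h0 h1
    obtain ⟨l, hl, hlU, hle⟩ := hR _ (hdecomp x hxW)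
    refine ⟨x - l, ⟨⟨?_, Λ.sub_mem hx hl⟩, W.sub_mem hxW (hUW hlU), ?_⟩, ?_⟩
    · rw [mem_closedBall_zero_iff]
      have : x - l = (x - f x • v - l) + f x • v := by abel
      rw [this]
      refine (norm_add_le _ _).trans (add_le_add hle ?_)
      rw [norm_smul, Real.norm_of_nonneg h0.le]
      exact mul_le_of_le_one_left (norm_nonneg _) h1
    · simpa [hfU l hlU] using h0
    · simp [hfU l hlU]
  obtain ⟨y₀, hy₀, hfy₀⟩ := hred v hv hvW (by rw [hfv]; exact one_pos) hfv.le
  obtain ⟨e, he, hmin⟩ := Set.exists_min_image F f hFfin ⟨y₀, hy₀⟩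
  have hfe : 0 < f e := he.2.2
  have hfe1 : f e ≤ 1 := (hmin y₀ hy₀).trans (by rw [hfy₀, hfv])
  have heU : e ∉ U := fun h => hfe.ne' (hfU e h)
  have hWe : U ⊔ Submodule.span ℝ {e} = W := by
    refine le_antisymm (sup_le hUW ?_) (sup_le le_sup_left ?_)
    · rw [Submodule.span_le, Set.singleton_subset_iff]
      exact he.2.1
    · rw [Submodule.span_le, Set.singleton_subset_iff]
      have h1 : v = (-(f e)⁻¹) • (e - f e • v) + (f e)⁻¹ • e := by
        rw [smul_sub, smul_smul, neg_mul, inv_mul_cancel₀ hfe.ne']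
        simp
      rw [h1]
      exact Submodule.add_mem_sup (U.smul_mem _ (hdecomp e he.2.1))
        (Submodule.smul_mem _ _ (Submodule.mem_span_singleton_self e))
  refine ⟨e, he.1.2, heU, hWe, fun x hx hxW => ⟨⌊f x / f e⌋, ?_⟩⟩
  rw [hWe] at hxW
  set y := x - ⌊f x / f e⌋ • e with hy
  have hyW : y ∈ W := W.sub_mem hxW (by
    rw [← Int.cast_smul_eq_zsmul ℝ]; exact W.smul_mem _ he.2.1)
  have hyΛ : y ∈ Λ := Λ.sub_mem hx (Λ.smul_mem _ he.1.2)
  have hfy : f y = Int.fract (f x / f e) * f e := by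
    rw [hy, map_sub, ← Int.cast_smul_eq_zsmul ℝ, map_smul, smul_eq_mul, Int.fract, sub_mul,
      div_mul_cancel₀ _ hfe.ne']
  have hfy0 : 0 ≤ f y := by rw [hfy]; exact mul_nonneg (Int.fract_nonneg _) hfe.le
  have hfy1 : f y < f e := by
    rw [hfy]; exact mul_lt_of_lt_one_left hfe (Int.fract_lt_one _)
  -- Division with remainder: a positive remainder would be smaller than the least positive value f
  -- e.
  have hfy2 : f y = 0 := by
    by_contra h
    obtain ⟨y', hy', hfy'⟩ := hred y hyΛ hyW (lt_of_le_of_ne hfy0 (Ne.symm h)) (by linarith)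
    linarith [hmin y' hy']
  have := hdecomp y hyW
  rwa [hfy2, zero_smul, sub_zero] at this

/-- One step in the construction of a lattice basis adapted to the successive minima. -/
theorem exists_next_basis_vector {E : Type*} [NormedAddCommGroup E] [NormedSpace ℝ E]
    [FiniteDimensional ℝ E] {K : Set E} (hK : IsSymmetricBody K) {Λ : Submodule ℤ E}
    [DiscreteTopology Λ] [IsZLattice ℝ Λ] {U : Submodule ℝ E} (hU : IsMinimaAdapted K Λ U)
    (hU' : IsLatticeSubspace Λ U) (hlt : Module.finrank ℝ U < Module.finrank ℝ E) :
    ∃ e ∈ Λ, e ∉ U ∧ (∀ x ∈ Λ, x ∈ U ⊔ Submodule.span ℝ {e} → ∃ n : ℤ, x - n • e ∈ U) ∧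
      IsMinimaAdapted K Λ (U ⊔ Submodule.span ℝ {e}) ∧
      IsLatticeSubspace Λ (U ⊔ Submodule.span ℝ {e}) ∧
      Module.finrank ℝ ↥(U ⊔ Submodule.span ℝ {e}) = Module.finrank ℝ U + 1 ∧
      ∃ v ∈ Λ, v ∉ U ∧ v ∈ U ⊔ Submodule.span ℝ {e} ∧
        ∀ x ∈ Λ, x ∉ U → ∀ r : ℝ, 0 < r → x ∈ r • K → v ∈ r • K := by
  have hex : ∃ x ∈ Λ, x ∉ U := by
    by_contra! h
    have h1 : (⊤ : Submodule ℝ E) ≤ U := by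
      rw [← IsZLattice.span_top (K := ℝ) (L := Λ)]
      exact Submodule.span_le.2 h
    rw [top_le_iff.1 h1, finrank_top] at hlt
    exact lt_irrefl _ hlt
  obtain ⟨v, hv, hvU, hmin⟩ := exists_lattice_minimizer hK Λ U hex
  obtain ⟨e, he, heU, heq, hprim⟩ := exists_primitive_complement hU' hv hvU
  refine ⟨e, he, heU, hprim, ?_, hU'.sup_span_singleton he,
    Submodule.finrank_sup_span_singleton heU, v, hv, hvU, ?_, hmin⟩
  · rw [heq]
    exact hU.sup_span_singleton hv hmin
  · rw [heq]
    exact Submodule.mem_sup_right (Submodule.mem_span_singleton_self v)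

/-- The first vector of the adapted basis can be chosen in every dilate of `K` that contains a
nonzero lattice point. -/
theorem mem_smul_of_primitive {E : Type*} [NormedAddCommGroup E] [NormedSpace ℝ E] {K : Set E}
    (hK : IsSymmetricBody K) {e v : E} {n : ℤ} (hv : v ≠ 0) (hvn : v = n • e) {r : ℝ} (hr : 0 < r)
    (h : v ∈ r • K) : e ∈ r • K := by
  have hn : n ≠ 0 := by
    rintro rfl
    exact hv (by rw [hvn, zero_smul])
  have hnR : (n : ℝ) ≠ 0 := by exact_mod_cast hn
  have h1 : (1 : ℝ) ≤ |(n : ℝ)| := by exact_mod_cast Int.one_le_abs hn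
  have : e = (n : ℝ)⁻¹ • v := by
    rw [hvn, ← Int.cast_smul_eq_zsmul ℝ, smul_smul, inv_mul_cancel₀ hnR, one_smul]
  rw [this]
  refine hK.smul_mem_smul h hr ?_
  rw [abs_mul, abs_inv, abs_of_pos hr]
  exact mul_le_of_le_one_left hr.le (inv_le_one_of_one_le₀ h1)

/-! ### Successive minima and packing conditions -/

/-- The radii over which the infimum in `successiveMinimum` is taken. -/
def minimaRadii {d : ℕ} (K : Set (EuclideanSpace ℝ (Fin d)))
    (Λ : Submodule ℤ (EuclideanSpace ℝ (Fin d))) (i : ℕ) : Set ℝ :=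
  {r : ℝ | 0 < r ∧ i ≤ Module.finrank ℝ
    (Submodule.span ℝ ((r • K) ∩ (Λ : Set (EuclideanSpace ℝ (Fin d)))))}

section Minima

variable {d : ℕ} {K : Set (EuclideanSpace ℝ (Fin d))}
  {Λ : Submodule ℤ (EuclideanSpace ℝ (Fin d))}

theorem bddBelow_minimaRadii (i : ℕ) : BddBelow (minimaRadii K Λ i) := ⟨0, fun _ hr => hr.1.le⟩

/-- Some dilate contains a whole lattice basis. For i ≤ d this keeps `sInf` from being the default
value 0 of the empty set. -/
theorem minimaRadii_nonempty (hK : IsSymmetricBody K) [DiscreteTopology Λ] [IsZLattice ℝ Λ]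
    {i : ℕ} (hi : i ≤ d) : (minimaRadii K Λ i).Nonempty := by
  let b := (Module.Free.chooseBasis ℤ Λ).ofZLatticeBasis ℝ Λ
  choose r hr hbr using fun j => hK.exists_mem_smul (b j)
  have hsum : ∀ j, r j ≤ 1 + ∑ j, r j := fun j => by
    have := Finset.single_le_sum (f := r) (fun j _ => (hr j).le) (Finset.mem_univ j)
    linarith
  refine ⟨1 + ∑ j, r j, by have := Finset.sum_nonneg fun j (_ : j ∈ Finset.univ) => (hr j).le
                           linarith, ?_⟩
  have htop : Submodule.span ℝ (((1 + ∑ j, r j) • K) ∩ (Λ : Set (EuclideanSpace ℝ (Fin d))))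
      = ⊤ := by
    rw [eq_top_iff, ← b.span_eq, Submodule.span_le]
    rintro _ ⟨j, rfl⟩
    refine Submodule.subset_span ⟨hK.smul_mono (hr j) (hsum j) (hbr j), ?_⟩
    simp [b]
  rw [htop, finrank_top, finrank_euclideanSpace_fin]
  exact hi

theorem exists_ne_zero_of_mem_minimaRadii {i : ℕ} (hi : 1 ≤ i) {r : ℝ}
    (hr : r ∈ minimaRadii K Λ i) : ∃ x ∈ Λ, x ≠ 0 ∧ x ∈ r • K := by
  by_contra! h
  have : Submodule.span ℝ ((r • K) ∩ (Λ : Set (EuclideanSpace ℝ (Fin d)))) = ⊥ := by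
    rw [Submodule.span_eq_bot]
    intro x hx
    by_contra h0
    exact h x hx.2 h0 hx.1
  have h2 := hr.2
  rw [this, finrank_bot] at h2
  omega

/-- Every admissible radius is at least the gauge of a shortest nonzero lattice vector. This fails
for i = 0, where the infimum is 0. -/
theorem successiveMinimum_pos (hK : IsSymmetricBody K) [DiscreteTopology Λ] [IsZLattice ℝ Λ]
    {i : ℕ} (hi : 1 ≤ i) (hid : i ≤ d) : 0 < successiveMinimum K Λ i := by
  obtain ⟨x₀, hx₀, hx₀0, -⟩ := exists_ne_zero_of_mem_minimaRadii hi
    (minimaRadii_nonempty (Λ := Λ) hK hid).some_mem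
  obtain ⟨v, hv, hv0, hmin⟩ := exists_lattice_minimizer hK Λ ⊥ ⟨x₀, hx₀, by simpa using hx₀0⟩
  have hg : 0 < gauge K v := (gauge_pos (absorbent_nhds_zero
    (mem_interior_iff_mem_nhds.1 hK.zero_mem_interior))
    (NormedSpace.isVonNBounded_of_isBounded ℝ hK.isCompact.isBounded)).2 (by simpa using hv0)
  refine hg.trans_le (le_csInf (minimaRadii_nonempty hK hid) fun r hr => ?_)
  obtain ⟨x, hx, hx0, hxr⟩ := exists_ne_zero_of_mem_minimaRadii hi hr
  exact (hK.mem_smul_iff_gauge_le hr.1).1 (hmin x hx (by simpa using hx0) r hr.1 hxr)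

theorem successiveMinimum_mono (hK : IsSymmetricBody K) [DiscreteTopology Λ] [IsZLattice ℝ Λ]
    {i j : ℕ} (hij : i ≤ j) (hj : j ≤ d) : successiveMinimum K Λ i ≤ successiveMinimum K Λ j :=
  csInf_le_csInf (bddBelow_minimaRadii i) (minimaRadii_nonempty hK hj)
    fun _ hr => ⟨hr.1, hij.trans hr.2⟩

/-- The lattice points of rK span U and also contain x outside U, so r is admissible for the index
dim U + 1. -/
theorem successiveMinimum_le_of_notMem {U : Submodule ℝ (EuclideanSpace ℝ (Fin d))}
    (hU : IsMinimaAdapted K Λ U) {x : EuclideanSpace ℝ (Fin d)} (hx : x ∈ Λ) (hxU : x ∉ U) {r : ℝ}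
    (hr : 0 < r) (hxr : x ∈ r • K) :
    successiveMinimum K Λ (Module.finrank ℝ U + 1) ≤ r := by
  refine csInf_le (bddBelow_minimaRadii _) ⟨hr, ?_⟩
  rw [← Submodule.finrank_sup_span_singleton hxU]
  refine Submodule.finrank_mono (sup_le (hU x hx hxU r hr hxr) ?_)
  rw [Submodule.span_le, Set.singleton_subset_iff]
  exact Submodule.subset_span ⟨hxr, hx⟩

/-- The strict inequality ⌊t + 1⌋ > t is the source of all packing conditions: q_i was chosen as the
least integer with q_i λ_i > 2. -/
theorem two_lt_floor_mul (hK : IsSymmetricBody K) [DiscreteTopology Λ] [IsZLattice ℝ Λ]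
    {i : ℕ} (hi : 1 ≤ i) (hid : i ≤ d) :
    2 < (⌊2 / successiveMinimum K Λ i + 1⌋₊ : ℝ) * successiveMinimum K Λ i := by
  have hpos := successiveMinimum_pos hK (Λ := Λ) hi hid
  rw [← div_lt_iff₀ hpos, Nat.floor_add_one (by positivity)]
  push_cast
  exact Nat.lt_floor_add_one _

theorem floor_pos (hK : IsSymmetricBody K) [DiscreteTopology Λ] [IsZLattice ℝ Λ]
    {i : ℕ} (hi : 1 ≤ i) (hid : i ≤ d) : 0 < ⌊2 / successiveMinimum K Λ i + 1⌋₊ := by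
  have hpos := successiveMinimum_pos hK (Λ := Λ) hi hid
  rw [Nat.floor_add_one (by positivity)]
  omega

theorem floor_anti (hK : IsSymmetricBody K) [DiscreteTopology Λ] [IsZLattice ℝ Λ]
    {i j : ℕ} (hi : 1 ≤ i) (hij : i ≤ j) (hj : j ≤ d) :
    ⌊2 / successiveMinimum K Λ j + 1⌋₊ ≤ ⌊2 / successiveMinimum K Λ i + 1⌋₊ := by
  have hpos := successiveMinimum_pos hK (Λ := Λ) hi (hij.trans hj)
  have := successiveMinimum_mono hK (Λ := Λ) hij hj
  gcongr

/-- Points of `K` that differ by a large multiple of a lattice point differ within the flag. -/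
theorem mem_of_sub_eq_smul (hK : IsSymmetricBody K) {U : Submodule ℝ (EuclideanSpace ℝ (Fin d))}
    (hU : IsMinimaAdapted K Λ U) {p p' x : EuclideanSpace ℝ (Fin d)} (hp : p ∈ K) (hp' : p' ∈ K)
    (hx : x ∈ Λ) {q : ℕ} (hq : 0 < q)
    (hq2 : 2 < (q : ℝ) * successiveMinimum K Λ (Module.finrank ℝ U + 1))
    (h : p - p' = (q : ℝ) • x) : x ∈ U := by
  by_contra hxU
  have hqR : (0 : ℝ) < q := by exact_mod_cast hq
  have h1 : x = (q : ℝ)⁻¹ • (p - p') := by rw [h, smul_smul, inv_mul_cancel₀ hqR.ne', one_smul]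
  have h2 : x ∈ (2 / q : ℝ) • K := by
    rw [h1]
    refine hK.smul_mem_smul (hK.sub_mem_smul hp hp') (by positivity) ?_
    rw [abs_of_nonneg (by positivity), inv_mul_eq_div]
  have := successiveMinimum_le_of_notMem hU hx hxU (by positivity) h2
  rw [le_div_iff₀ hqR] at this
  linarith

/-- The extent of planar sections of `K` transversally to a shortest lattice vector `e₁`. -/
theorem sub_coordinate_lt (hK : IsSymmetricBody K) [DiscreteTopology Λ] [IsZLattice ℝ Λ]
    {U : Submodule ℝ (EuclideanSpace ℝ (Fin d))} (hU : IsMinimaAdapted K Λ U)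
    (hU1 : Module.finrank ℝ U = 1) (hd : 2 ≤ d) {e₁ e₂ : EuclideanSpace ℝ (Fin d)} (he₁ : e₁ ∈ Λ)
    (he₂ : e₂ ∈ Λ) (he₁U : e₁ ∈ U) (he₂U : e₂ ∉ U)
    (hmin : ∀ x ∈ Λ, x ≠ 0 → ∀ r : ℝ, 0 < r → x ∈ r • K → e₁ ∈ r • K)
    {p p' : EuclideanSpace ℝ (Fin d)} (hp : p ∈ K) (hp' : p' ∈ K) {q : ℕ} (hq : 0 < q)
    (hq2 : 2 < (q : ℝ) * successiveMinimum K Λ 2) {α β : ℝ} (h : p - p' = α • e₁ + β • e₂) :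
    β < 2 * q := by
  by_contra! hβ
  have hqR : (0 : ℝ) < q := by exact_mod_cast hq
  have hβ0 : 0 < β := by linarith
  -- If β ≥ 2q, then e₂ + (α/β)e₁ lies in K/q. Rounding α/β to n moves it by at most e₁/2, and e₁ ∈
  -- rK for every r admissible for λ₂. So n e₁ + e₂ gives λ₂ ≤ 1/q + r/2; taking the infimum over r,
  -- λ₂ ≤ 2/q, a contradiction.
  set n : ℤ := round (α / β) with hn
  have hround : |(n : ℝ) - α / β| ≤ 1 / 2 := by
    rw [abs_sub_comm]; exact abs_sub_round _
  have hx : n • e₁ + e₂ ∈ Λ := Λ.add_mem (Λ.smul_mem _ he₁) he₂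
  have hxU : n • e₁ + e₂ ∉ U := fun hmem => he₂U (by
    have h1 : n • e₁ ∈ U := by rw [← Int.cast_smul_eq_zsmul ℝ]; exact U.smul_mem _ he₁U
    simpa using U.sub_mem hmem h1)
  have key : ∀ r ∈ minimaRadii K Λ 2, 2 * (successiveMinimum K Λ 2 - 1 / q) ≤ r := by
    intro r hr
    obtain ⟨x, hxΛ, hx0, hxr⟩ := exists_ne_zero_of_mem_minimaRadii (by norm_num) hr
    have he := hmin x hxΛ hx0 r hr.1 hxr
    have hmem : n • e₁ + e₂ ∈ (1 / q + r / 2 : ℝ) • K := by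
      rw [hK.convex.add_smul (by positivity) (half_pos hr.1).le, Set.mem_add]
      refine ⟨β⁻¹ • (p - p'), hK.smul_mem_smul (hK.sub_mem_smul hp hp') (by positivity) ?_,
        ((n : ℝ) - α / β) • e₁, hK.smul_mem_smul he (half_pos hr.1) ?_, ?_⟩
      · rw [abs_of_nonneg (by positivity), inv_mul_eq_div, div_le_div_iff₀ hβ0 hqR]
        linarith
      · rw [abs_mul, abs_of_pos hr.1]
        nlinarith [hr.1]
      · rw [h, smul_add, smul_smul, smul_smul, inv_mul_cancel₀ hβ0.ne', one_smul, sub_smul,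
          Int.cast_smul_eq_zsmul, inv_mul_eq_div]
        abel
    have := successiveMinimum_le_of_notMem hU hx hxU (by have := hr.1; positivity) hmem
    rw [hU1] at this
    norm_num at this ⊢
    linarith
  have h1 : 2 * (successiveMinimum K Λ 2 - 1 / q) ≤ successiveMinimum K Λ 2 :=
    le_csInf (minimaRadii_nonempty hK hd) key
  have h2 : successiveMinimum K Λ 2 ≤ 2 / q := by
    have : (2 : ℝ) / q = 2 * (1 / q) := by ring
    rw [this]; linarith
  rw [le_div_iff₀ hqR] at h2
  linarith

end Minima

/-! ### Passage to coordinates in dimensions one to three -/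

theorem Submodule.eq_zero_of_smul_add_mem {E : Type*} [AddCommGroup E] [Module ℝ E]
    {U : Submodule ℝ E} {u e : E} {c : ℝ} (he : e ∉ U) (hu : u ∈ U) (h : u + c • e ∈ U) :
    c = 0 := by
  by_contra hc
  have h1 : c • e ∈ U := by simpa using U.sub_mem h hu
  exact he ((U.smul_mem_iff hc).1 h1)

theorem Submodule.cast_smul_mem {E : Type*} [AddCommGroup E] [Module ℝ E] (Λ : Submodule ℤ E)
    {e : E} (he : e ∈ Λ) (n : ℤ) : (n : ℝ) • e ∈ Λ := by
  rw [Int.cast_smul_eq_zsmul]; exact Λ.smul_mem _ he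

theorem encard_le_card_of_forall_exists {α β : Type*} {s : Set β} (A : Finset α) (g : α → β)
    (h : ∀ x ∈ s, ∃ a ∈ A, g a = x) : s.encard ≤ A.card := by
  have h1 : s ⊆ g '' A := fun x hx => by
    obtain ⟨a, ha, rfl⟩ := h x hx
    exact ⟨a, ha, rfl⟩
  exact (Set.encard_le_encard h1).trans
    ((Set.encard_image_le _ _).trans (Set.encard_coe_eq_coe_finsetCard A).le)

/-- A shortest lattice vector which is primitive. -/
theorem exists_first_basis_vector {d : ℕ} (hd : 1 ≤ d) {K : Set (EuclideanSpace ℝ (Fin d))}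
    (hK : IsSymmetricBody K) (Λ : Submodule ℤ (EuclideanSpace ℝ (Fin d))) [DiscreteTopology Λ]
    [IsZLattice ℝ Λ] :
    ∃ e ∈ Λ, e ≠ 0 ∧ (∀ x ∈ Λ, x ∈ Submodule.span ℝ {e} → ∃ n : ℤ, x = (n : ℝ) • e) ∧
      IsMinimaAdapted K Λ (Submodule.span ℝ {e}) ∧ IsLatticeSubspace Λ (Submodule.span ℝ {e}) ∧
      Module.finrank ℝ (Submodule.span ℝ {e}) = 1 ∧
      ∀ x ∈ Λ, x ≠ 0 → ∀ r : ℝ, 0 < r → x ∈ r • K → e ∈ r • K := by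
  obtain ⟨e, he, he0, hprim, had, hlat, -, v, hv, hv0, hvs, hmin⟩ :=
    exists_next_basis_vector hK (isMinimaAdapted_bot K Λ) (isLatticeSubspace_bot Λ)
      (by rw [finrank_bot, finrank_euclideanSpace_fin]; omega)
  obtain ⟨n, hn⟩ := hprim v hv hvs
  rw [Submodule.mem_bot, sub_eq_zero] at hn
  simp only [bot_sup_eq, Submodule.mem_bot] at *
  refine ⟨e, he, he0, fun x hx hxs => ?_, had, hlat, finrank_span_singleton he0, fun x hx hx0 r hr hxr =>
    mem_smul_of_primitive hK hv0 hn hr (hmin x hx hx0 r hr hxr)⟩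
  obtain ⟨m, hm⟩ := hprim x hx hxs
  exact ⟨m, by rw [Int.cast_smul_eq_zsmul, ← sub_eq_zero, hm]⟩

theorem latticePointEnumerator_le_one_dim {K : Set (EuclideanSpace ℝ (Fin 1))}
    (hK : IsSymmetricBody K) (Λ : Submodule ℤ (EuclideanSpace ℝ (Fin 1))) [DiscreteTopology Λ]
    [IsZLattice ℝ Λ] :
    latticePointEnumerator K Λ ≤ ((⌊2 / successiveMinimum K Λ 1 + 1⌋₊ : ℕ) : ℕ∞) := by
  obtain ⟨e, he, he0, hprim, -, -, hfr, -⟩ := exists_first_basis_vector le_rfl hK Λ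
  have htop : Submodule.span ℝ {e} = ⊤ :=
    Submodule.eq_top_of_finrank_eq (by rw [hfr, finrank_euclideanSpace_fin])
  have hinj : Function.Injective fun n : ℤ => (n : ℝ) • e := fun m n h => by
    exact_mod_cast smul_left_injective ℝ he0 h
  have hfin : {n : ℤ | (n : ℝ) • e ∈ K}.Finite :=
    ((finite_inter_lattice Λ hK.isCompact.isBounded).preimage hinj.injOn).subset
      fun n hn => ⟨hn, Λ.cast_smul_mem he n⟩
  refine (encard_le_card_of_forall_exists hfin.toFinset (fun n : ℤ => (n : ℝ) • e) ?_).trans ?_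
  · rintro x ⟨hxK, hxΛ⟩
    obtain ⟨n, rfl⟩ := hprim x hxΛ (by rw [htop]; exact Submodule.mem_top)
    exact ⟨n, by simpa using hxK, rfl⟩
  · have hq := floor_pos hK (Λ := Λ) le_rfl le_rfl
    rw [Nat.cast_le]
    -- A single row with both moduli equal to q₁, so disjointness is vacuous.
    refine card_le_of_rows _ (fun _ => ()) id _ _ hq le_rfl (fun a _ b _ _ h => h) ?_ ?_ ?_
    · intro a ha b hb _ z hz hz'
      refine ⟨z, ?_, rfl, rfl⟩
      rw [Set.Finite.mem_toFinset] at ha hb ⊢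
      have hoc := (hK.convex.linear_preimage (LinearMap.toSpanSingleton ℝ _ e)).ordConnected
      have h1 : (a : ℝ) ≤ z := Int.cast_le.2 hz
      have h2 : (z : ℝ) ≤ b := Int.cast_le.2 hz'
      exact hoc.out (x := (a : ℝ)) (y := (b : ℝ)) ha hb ⟨h1, h2⟩
    · intro a _ b _ h
      exact (h rfl).elim
    · intro a ha b hb _ h
      rw [Set.Finite.mem_toFinset] at ha hb
      simp only [id] at h
      have := mem_of_sub_eq_smul hK (isMinimaAdapted_bot K Λ) hb ha he hq
        (by rw [finrank_bot]; exact two_lt_floor_mul hK le_rfl le_rfl) (by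
          rw [h, ← sub_smul]; push_cast; rw [add_sub_cancel_left])
      exact he0 (by simpa using this)

theorem latticePointEnumerator_le_two_dim {K : Set (EuclideanSpace ℝ (Fin 2))}
    (hK : IsSymmetricBody K) (Λ : Submodule ℤ (EuclideanSpace ℝ (Fin 2))) [DiscreteTopology Λ]
    [IsZLattice ℝ Λ] :
    latticePointEnumerator K Λ ≤ ((⌊2 / successiveMinimum K Λ 1 + 1⌋₊ *
      ⌊2 / successiveMinimum K Λ 2 + 1⌋₊ : ℕ) : ℕ∞) := by
  obtain ⟨e₁, he₁, he₁0, hprim₁, had₁, hlat₁, hfr₁, hmin⟩ :=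
    exists_first_basis_vector (by norm_num) hK Λ
  obtain ⟨e₂, he₂, he₂U, hprim₂, -, -, hfr₂, -⟩ := exists_next_basis_vector hK had₁ hlat₁
    (by rw [hfr₁, finrank_euclideanSpace_fin]; norm_num)
  set W₁ := Submodule.span ℝ {e₁} with hW₁
  have he₁W : e₁ ∈ W₁ := Submodule.mem_span_singleton_self e₁
  have htop : W₁ ⊔ Submodule.span ℝ {e₂} = ⊤ :=
    Submodule.eq_top_of_finrank_eq (by rw [hfr₂, hfr₁, finrank_euclideanSpace_fin])
  let M : ℝ × ℝ →ₗ[ℝ] EuclideanSpace ℝ (Fin 2) :=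
    (LinearMap.toSpanSingleton ℝ _ e₁).coprod (LinearMap.toSpanSingleton ℝ _ e₂)
  have hM : ∀ p, M p = p.1 • e₁ + p.2 • e₂ := fun p => by simp [M]
  have hMinj : Function.Injective M := by
    rw [injective_iff_map_eq_zero]
    intro p hp
    rw [hM] at hp
    have h2 : p.2 = 0 := Submodule.eq_zero_of_smul_add_mem he₂U (W₁.smul_mem p.1 he₁W)
      (by rw [hp]; exact W₁.zero_mem)
    have h1 : p.1 = 0 := by simpa [h2, he₁0] using hp
    exact Prod.ext h1 h2
  have hMΛ : ∀ a b : ℤ, M (a, b) ∈ Λ := fun a b => by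
    rw [hM]
    exact Λ.add_mem (Λ.cast_smul_mem he₁ a) (Λ.cast_smul_mem he₂ b)
  have hcast : Function.Injective fun x : ℤ × ℤ => M ((x.1 : ℝ), (x.2 : ℝ)) := fun x y h => by
    have := hMinj h
    simpa [Prod.ext_iff] using this
  have hfin : {x : ℤ × ℤ | M ((x.1 : ℝ), (x.2 : ℝ)) ∈ K}.Finite :=
    ((finite_inter_lattice Λ hK.isCompact.isBounded).preimage hcast.injOn).subset
      fun x hx => ⟨hx, hMΛ _ _⟩
  refine (encard_le_card_of_forall_exists hfin.toFinset
    (fun x : ℤ × ℤ => M ((x.1 : ℝ), (x.2 : ℝ))) ?_).trans ?_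
  · rintro x ⟨hxK, hxΛ⟩
    obtain ⟨n₂, hn₂⟩ := hprim₂ x hxΛ (by rw [htop]; exact Submodule.mem_top)
    obtain ⟨n₁, hn₁⟩ := hprim₁ _ (Λ.sub_mem hxΛ (Λ.smul_mem n₂ he₂)) hn₂
    have hx : M ((n₁ : ℝ), (n₂ : ℝ)) = x := by
      rw [hM, ← hn₁, Int.cast_smul_eq_zsmul, sub_add_cancel]
    exact ⟨(n₁, n₂), by simpa [hx] using hxK, hx⟩
  rw [Nat.cast_le]
  have hemb := LinearMap.isClosedEmbedding_of_injective (LinearMap.ker_eq_bot.2 hMinj)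
  have hq₁ := floor_pos hK (Λ := Λ) (i := 1) le_rfl (by norm_num)
  have hq₂ := floor_pos hK (Λ := Λ) (i := 2) (by norm_num) le_rfl
  have ht₁ := two_lt_floor_mul hK (Λ := Λ) (i := 1) le_rfl (by norm_num)
  have ht₂ := two_lt_floor_mul hK (Λ := Λ) (i := 2) (by norm_num) le_rfl
  have hanti := floor_anti hK (Λ := Λ) (i := 1) (j := 2) le_rfl (by norm_num) le_rfl
  generalize ⌊2 / successiveMinimum K Λ 1 + 1⌋₊ = q₁ at *
  generalize ⌊2 / successiveMinimum K Λ 2 + 1⌋₊ = q₂ at *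
  have hsub : ∀ p p' : ℝ × ℝ, ∀ (q : ℕ) (a b : ℤ), p.1 - p'.1 = q * a → p.2 - p'.2 = q * b →
      M p - M p' = (q : ℝ) • M (a, b) := by
    intro p p' q a b h h'
    rw [← map_sub, ← map_smul]
    exact congrArg M (Prod.ext h h')
  -- The plane needs no missed residues: N is empty and q is taken to be q₂.
  have := card_planar_add_card_missing_le (C := M ⁻¹' K) (hemb.isCompact_preimage hK.isCompact)
    (hK.convex.linear_preimage M) hq₂ le_rfl hanti ?_ ?_ ?_ hfin.toFinset ∅ ?_ (by simp) (by simp)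
  · simpa using this
  · intro p hp p' hp' a b h h'
    have hmem := mem_of_sub_eq_smul hK had₁ hp hp' (hMΛ a b) hq₂ (by rw [hfr₁]; exact ht₂)
      (hsub p p' _ a b h h')
    rw [hM] at hmem
    exact Int.cast_eq_zero.1 <| Submodule.eq_zero_of_smul_add_mem he₂U (W₁.smul_mem _ he₁W) hmem
  · intro p hp p' hp' a h h'
    have hmem := mem_of_sub_eq_smul hK (isMinimaAdapted_bot K Λ) hp hp' (hMΛ a 0) hq₁
      (by rw [finrank_bot]; exact ht₁) (hsub p p' _ a 0 h (by simp [h']))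
    simpa [hM, he₁0] using hmem
  · intro p hp p' hp'
    refine sub_coordinate_lt hK had₁ hfr₁ le_rfl he₁ he₂ he₁W he₂U hmin hp hp' hq₂ ht₂
      (α := p.1 - p'.1) ?_
    rw [← map_sub, hM]
    rfl
  · intro x
    simp

theorem latticePointEnumerator_le_three_dim {K : Set (EuclideanSpace ℝ (Fin 3))}
    (hK : IsSymmetricBody K) (Λ : Submodule ℤ (EuclideanSpace ℝ (Fin 3))) [DiscreteTopology Λ]
    [IsZLattice ℝ Λ] :
    latticePointEnumerator K Λ ≤ ((⌊2 / successiveMinimum K Λ 1 + 1⌋₊ *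
      ⌊2 / successiveMinimum K Λ 2 + 1⌋₊ * ⌊2 / successiveMinimum K Λ 3 + 1⌋₊ : ℕ) : ℕ∞) := by
  obtain ⟨e₁, he₁, he₁0, hprim₁, had₁, hlat₁, hfr₁, hmin⟩ :=
    exists_first_basis_vector (by norm_num) hK Λ
  obtain ⟨e₂, he₂, he₂U, hprim₂, had₂, hlat₂, hfr₂, -⟩ := exists_next_basis_vector hK had₁ hlat₁
    (by rw [hfr₁, finrank_euclideanSpace_fin]; norm_num)
  rw [hfr₁] at hfr₂
  set W₁ := Submodule.span ℝ {e₁} with hW₁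
  have he₁W : e₁ ∈ W₁ := Submodule.mem_span_singleton_self e₁
  set W₂ := W₁ ⊔ Submodule.span ℝ {e₂} with hW₂
  have he₁W₂ : e₁ ∈ W₂ := Submodule.mem_sup_left he₁W
  have he₂W₂ : e₂ ∈ W₂ := Submodule.mem_sup_right (Submodule.mem_span_singleton_self e₂)
  obtain ⟨e₃, he₃, he₃U, hprim₃, -, -, hfr₃, -⟩ := exists_next_basis_vector hK had₂ hlat₂
    (by rw [hfr₂, finrank_euclideanSpace_fin]; norm_num)
  have htop : W₂ ⊔ Submodule.span ℝ {e₃} = ⊤ :=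
    Submodule.eq_top_of_finrank_eq (by rw [hfr₃, hfr₂, finrank_euclideanSpace_fin])
  let M : (ℝ × ℝ) × ℝ →ₗ[ℝ] EuclideanSpace ℝ (Fin 3) :=
    ((LinearMap.toSpanSingleton ℝ _ e₁).coprod (LinearMap.toSpanSingleton ℝ _ e₂)).coprod
      (LinearMap.toSpanSingleton ℝ _ e₃)
  have hM : ∀ p, M p = p.1.1 • e₁ + p.1.2 • e₂ + p.2 • e₃ := fun p => by simp [M]
  have hW₂mem : ∀ a b : ℝ, a • e₁ + b • e₂ ∈ W₂ := fun a b =>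
    W₂.add_mem (W₂.smul_mem a he₁W₂) (W₂.smul_mem b he₂W₂)
  have hMinj : Function.Injective M := by
    rw [injective_iff_map_eq_zero]
    intro p hp
    rw [hM] at hp
    have h3 : p.2 = 0 := Submodule.eq_zero_of_smul_add_mem he₃U (hW₂mem _ _)
      (by rw [hp]; exact W₂.zero_mem)
    rw [h3, zero_smul, add_zero] at hp
    have h2 : p.1.2 = 0 := Submodule.eq_zero_of_smul_add_mem he₂U (W₁.smul_mem p.1.1 he₁W)
      (by rw [hp]; exact W₁.zero_mem)
    have h1 : p.1.1 = 0 := by simpa [h2, he₁0] using hp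
    exact Prod.ext (Prod.ext h1 h2) h3
  have hMΛ : ∀ a b c : ℤ, M ((a, b), c) ∈ Λ := fun a b c => by
    rw [hM]
    exact Λ.add_mem (Λ.add_mem (Λ.cast_smul_mem he₁ a) (Λ.cast_smul_mem he₂ b))
      (Λ.cast_smul_mem he₃ c)
  have hcast : Function.Injective
      fun x : (ℤ × ℤ) × ℤ => M (((x.1.1 : ℝ), (x.1.2 : ℝ)), (x.2 : ℝ)) := fun x y h => by
    have := hMinj h
    simpa [Prod.ext_iff] using this
  have hfin : {x : (ℤ × ℤ) × ℤ | M (((x.1.1 : ℝ), (x.1.2 : ℝ)), (x.2 : ℝ)) ∈ K}.Finite :=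
    ((finite_inter_lattice Λ hK.isCompact.isBounded).preimage hcast.injOn).subset
      fun x hx => ⟨hx, hMΛ _ _ _⟩
  refine (encard_le_card_of_forall_exists hfin.toFinset
    (fun x : (ℤ × ℤ) × ℤ => M (((x.1.1 : ℝ), (x.1.2 : ℝ)), (x.2 : ℝ))) ?_).trans ?_
  · rintro x ⟨hxK, hxΛ⟩
    obtain ⟨n₃, hn₃⟩ := hprim₃ x hxΛ (by rw [htop]; exact Submodule.mem_top)
    have hx₃ := Λ.sub_mem hxΛ (Λ.smul_mem n₃ he₃)
    obtain ⟨n₂, hn₂⟩ := hprim₂ _ hx₃ hn₃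
    obtain ⟨n₁, hn₁⟩ := hprim₁ _ (Λ.sub_mem hx₃ (Λ.smul_mem n₂ he₂)) hn₂
    have hx : M (((n₁ : ℝ), (n₂ : ℝ)), (n₃ : ℝ)) = x := by
      rw [hM, ← hn₁, Int.cast_smul_eq_zsmul, Int.cast_smul_eq_zsmul, sub_add_cancel,
        sub_add_cancel]
    exact ⟨((n₁, n₂), n₃), by simpa [hx] using hxK, hx⟩
  rw [Nat.cast_le]
  have hemb := LinearMap.isClosedEmbedding_of_injective (LinearMap.ker_eq_bot.2 hMinj)
  have hq₁ := floor_pos hK (Λ := Λ) (i := 1) le_rfl (by norm_num)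
  have hq₂ := floor_pos hK (Λ := Λ) (i := 2) (by norm_num) (by norm_num)
  have hq₃ := floor_pos hK (Λ := Λ) (i := 3) (by norm_num) le_rfl
  have ht₁ := two_lt_floor_mul hK (Λ := Λ) (i := 1) le_rfl (by norm_num)
  have ht₂ := two_lt_floor_mul hK (Λ := Λ) (i := 2) (by norm_num) (by norm_num)
  have ht₃ := two_lt_floor_mul hK (Λ := Λ) (i := 3) (by norm_num) le_rfl
  have hanti := floor_anti hK (Λ := Λ) (i := 1) (j := 2) le_rfl (by norm_num) (by norm_num)
  have hanti' := floor_anti hK (Λ := Λ) (i := 2) (j := 3) (by norm_num) (by norm_num) le_rfl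
  generalize ⌊2 / successiveMinimum K Λ 1 + 1⌋₊ = q₁ at *
  generalize ⌊2 / successiveMinimum K Λ 2 + 1⌋₊ = q₂ at *
  generalize ⌊2 / successiveMinimum K Λ 3 + 1⌋₊ = q₃ at *
  have hsub : ∀ p p' : (ℝ × ℝ) × ℝ, ∀ (q : ℕ) (a b c : ℤ), p.1.1 - p'.1.1 = q * a →
      p.1.2 - p'.1.2 = q * b → p.2 - p'.2 = q * c → M p - M p' = (q : ℝ) • M ((a, b), c) := by
    intro p p' q a b c h h' h''
    rw [← map_sub, ← map_smul]
    exact congrArg M (Prod.ext (Prod.ext h h') h'')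
  refine card_le_of_packing (C := M ⁻¹' K) (hemb.isCompact_preimage hK.isCompact)
    (hK.convex.linear_preimage M) hq₃ hanti' hanti ?_ ?_ ?_ ?_ hfin.toFinset ?_
  · intro p hp p' hp' a b c h h' h''
    have hmem := mem_of_sub_eq_smul hK had₂ hp hp' (hMΛ a b c) hq₃ (by rw [hfr₂]; exact ht₃)
      (hsub p p' _ a b c h h' h'')
    rw [hM] at hmem
    exact Int.cast_eq_zero.1 <| Submodule.eq_zero_of_smul_add_mem he₃U (hW₂mem _ _) hmem
  · intro p p' z hp hp' a b h h'
    have hmem := mem_of_sub_eq_smul hK had₁ hp hp' (hMΛ a b 0) hq₂ (by rw [hfr₁]; exact ht₂)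
      (hsub (p, z) (p', z) _ a b 0 h h' (by simp))
    rw [hM] at hmem
    simp only [Int.cast_zero, zero_smul, add_zero] at hmem
    exact Int.cast_eq_zero.1 <| Submodule.eq_zero_of_smul_add_mem he₂U (W₁.smul_mem _ he₁W) hmem
  · intro p p' z hp hp' a b h h'
    have hmem := mem_of_sub_eq_smul hK (isMinimaAdapted_bot K Λ) hp hp' (hMΛ a b 0) hq₁
      (by rw [finrank_bot]; exact ht₁) (hsub (p, z) (p', z) _ a b 0 h h' (by simp))
    rw [Submodule.mem_bot, ← map_zero M] at hmem
    have := hMinj hmem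
    simpa [Prod.ext_iff] using this
  · intro p p' z hp hp'
    refine sub_coordinate_lt hK had₁ hfr₁ (by norm_num) he₁ he₂ he₁W he₂U hmin hp hp' hq₂ ht₂
      (α := p.1 - p'.1) ?_
    rw [← map_sub, hM]
    simp
  · intro x
    simp

theorem ConvexBody.isSymmetricBody {E : Type*} [NormedAddCommGroup E] [NormedSpace ℝ E]
    (K : ConvexBody E) (hint : (interior (K : Set E)).Nonempty) (hsymm : ∀ x ∈ K, -x ∈ K) :
    IsSymmetricBody (K : Set E) where
  isCompact := K.isCompact
  convex := K.convex
  neg_mem := hsymm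
  zero_mem_interior := by
    obtain ⟨x, hx⟩ := hint
    have := K.convex.combo_interior_self_mem_interior hx (hsymm x (interior_subset hx))
      (a := 1 / 2) (b := 1 / 2) (by norm_num) (by norm_num) (by norm_num)
    simpa using this

theorem mainTheorem1 (d : ℕ) (hd : d ≤ 3)
    (K : ConvexBody (EuclideanSpace ℝ (Fin d)))
    (hK_int : (interior (K : Set (EuclideanSpace ℝ (Fin d)))).Nonempty)
    (hK_symm : ∀ x ∈ K, -x ∈ K)
    (Λ : Submodule ℤ (EuclideanSpace ℝ (Fin d)))
    [DiscreteTopology Λ] [IsZLattice ℝ Λ] :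
    latticePointEnumerator (K : Set (EuclideanSpace ℝ (Fin d))) Λ ≤
      ((∏ i ∈ Finset.Icc 1 d,
        ⌊2 / successiveMinimum (K : Set (EuclideanSpace ℝ (Fin d))) Λ i + 1⌋₊ : ℕ) : ℕ∞) := by
  have hK := K.isSymmetricBody hK_int hK_symm
  interval_cases d
  · simpa [latticePointEnumerator] using
      (Set.encard_le_one_iff.2 fun a b _ _ => Subsingleton.elim a b :
        ((K : Set (EuclideanSpace ℝ (Fin 0))) ∩ Λ).encard ≤ 1)
  · simpa using latticePointEnumerator_le_one_dim hK Λ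
  · simpa [Finset.prod_Icc_succ_top] using latticePointEnumerator_le_two_dim hK Λ
  · simpa [Finset.prod_Icc_succ_top] using latticePointEnumerator_le_three_dim hK Λ
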